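/- Let $k$ be a commutative ring, let $\mathcal M_k$ be the monoidal category of $k$-modules, with the tensor product $\otimes$ over $k$, let $\mathcal C$ be a $k$-linear category and let $G\colon\mathcal C\to\mathcal M_k$ be a $k$-linear functor. A weak bialgebra over $k$ is a (unital, associative) $k$-algebra $A$ together with a coassociative counital $k$-coalgebra structure $(\Delta,\epsilon)$ on $A$ such that, with $\Delta(b)=b_{(1)}\otimes b_{(2)}$, for all $a,b,c\in A$, $$\Delta(ab)=\Delta(a)\Delta(b),\qquad \epsilon(abc)=\epsilon(ab_{(1)})\,\epsilon(b_{(2)}c)=\epsilon(ab_{(2)})\,\epsilon(b_{(1)}c),$$ $$(\Delta\otimes\mathrm{id})\Delta(1)=(\Delta(1)\otimes1)(1\otimes\Delta(1))=(1\otimes\Delta(1))(\Delta(1)\otimes1).$$ Its long forgetful functor is the functor $G^A\colon\mathcal M_A\to\mathcal M_k$ which sends a right $A$-module to its underlying $k$-module. A separable Frobenius structure on a functor $G\colon\mathcal C\to\mathcal M$ between monoidal categories $(\mathcal C,\square,E)$ and $(\mathcal M,\otimes,I)$ consists of natural transformations $G_{X,Y}\colon GX\otimes GY\to G(X\square Y)$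 and $G^{X,Y}\colon G(X\square Y)\to GX\otimes GY$ and arrows $G_0\colon I\to GE$ and $G^0\colon GE\to I$ such that $(G,G_2,G_0)$ is a (lax) monoidal functor, $(G,G^2,G^0)$ is an opmonoidal functor and, for all objects $X,Y,Z$ of $\mathcal C$, $$(G_{X,Y}\otimes GZ)\circ\mathbf a_{GX,GY,GZ}\circ(GX\otimes G^{Y,Z})=G^{X\square Y,Z}\circ G\mathbf a_{X,Y,Z}\circ G_{X,Y\square Z},$$ $$(GX\otimes G_{Y,Z})\circ\mathbf a^{-1}_{GX,GY,GZ}\circ(G^{X,Y}\otimes GZ)=G^{X,Y\square Z}\circ G\mathbf a^{-1}_{X,Y,Z}\circ G_{X\square Y,Z},$$ $$G_{X,Y}\circ G^{X,Y}=\mathrm{id}_{G(X\square Y)},$$ where $\mathbf a_{X,Y,Z}\colon X\square(Y\square Z)\to(X\square Y)\square Z$ is the associator of $\mathcal C$, and similarly for $\mathcal M$. Then the following are equivalent. (A) $G$ is equivalent, as an object of $k\text{-}\mathsf{Cat}/\mathcal M_k$, to the long forgetful functor of a weak bialgebra, i.e. there are a weak bialgebra $A$ over $k$, a $k$-linear equivalence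 of categories $K\colon\mathcal C\to\mathcal M_A$ and a natural isomorphism $G\cong G^A K$. (B) The following three conditions hold: 1. $G$ is monadic, i.e. $G$ has a left adjoint $F$ and the comparison functor from $\mathcal C$ to the Eilenberg–Moore category of the monad $GF$ is an equivalence of categories; 2. $G$ has a right adjoint; 3. $G$ carries a separable Frobenius structure, i.e. there are a $k$-linear monoidal structure on $\mathcal C$ (with $\square$ being $k$-bilinear on arrows) and a separable Frobenius structure on $G$ with respect to it and to the tensor product of $\mathcal M_k$. -/

import Mathlib

open CategoryTheory MonoidalCategory
open scoped TensorProduct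

universe u v₁ v₂ v₃ u₁ u₂ u₃

noncomputable section

/-! ### Weak bialgebras -/

/-- A weak bialgebra over a commutative ring `k`: a `k`-algebra `A` which is also a `k`-coalgebra
`(A, Δ, ε)` such that `Δ` is multiplicative (but need not preserve the unit), while `Δ(1)` and `ε`
satisfy the weak (co)multiplicativity axioms. There is no finiteness or flatness condition on `A`
over `k`. -/
class WeakBialgebra (k : Type*) (A : Type*) [CommRing k] [Ring A] [Algebra k A] extends
    Coalgebra k A where
  /-- `Δ(ab) = Δ(a) Δ(b)`. -/
  comul_mul : ∀ a b : A, comul (a * b) = comul a * comul b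
  /-- `(Δ ⊗ id)(Δ(1)) = (Δ(1) ⊗ 1) (1 ⊗ Δ(1))`. -/
  comul_comul_one : comul.rTensor A (comul 1) =
    (comul 1 ⊗ₜ[k] (1 : A)) * (TensorProduct.assoc k A A A).symm ((1 : A) ⊗ₜ[k] comul 1)
  /-- `(Δ ⊗ id)(Δ(1)) = (1 ⊗ Δ(1)) (Δ(1) ⊗ 1)`. -/
  comul_comul_one' : comul.rTensor A (comul 1) =
    (TensorProduct.assoc k A A A).symm ((1 : A) ⊗ₜ[k] comul 1) * (comul 1 ⊗ₜ[k] (1 : A))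
  /-- `ε(abc) = ε(a b₁) ε(b₂ c)`, where `Δ(b) = b₁ ⊗ b₂`. -/
  counit_mul_mul : ∀ a b c : A, counit (a * b * c) =
    LinearMap.mul' k k (TensorProduct.map
      (counit ∘ₗ LinearMap.mulLeft k a) (counit ∘ₗ LinearMap.mulRight k c) (comul b))
  /-- `ε(abc) = ε(a b₂) ε(b₁ c)`, where `Δ(b) = b₁ ⊗ b₂`. -/
  counit_mul_mul' : ∀ a b c : A, counit (a * b * c) =
    LinearMap.mul' k k (TensorProduct.map
      (counit ∘ₗ LinearMap.mulRight k c) (counit ∘ₗ LinearMap.mulLeft k a) (comul b))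

/-- The category `M_A` of right `A`-modules, i.e. of modules over the opposite algebra. -/
abbrev RightModuleCat (A : Type u) [Ring A] : Type (u + 1) := ModuleCat.{u} Aᵐᵒᵖ

/-- If `A` is a `k`-algebra then `M_A` is a `k`-linear category, with scalars acting pointwise. -/
instance rightModuleCatLinear (k A : Type u) [CommRing k] [Ring A] [Algebra k A] :
    CategoryTheory.Linear k (RightModuleCat A) :=
  ModuleCat.Algebra.instLinear

/-- The long forgetful functor `M_A ⥤ M_k`, sending a right `A`-module to its underlying
`k`-module. For a weak bialgebra `A` with canonical right subalgebra `R`, the functor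
`M_A ⥤ _R M_R` only restricts the action of `A` to actions of `R`, hence its composite with the
forgetful functor `_R M_R ⥤ M_k` is this functor. -/
def longForgetful (k A : Type u) [CommRing k] [Ring A] [Algebra k A] :
    RightModuleCat A ⥤ ModuleCat.{u} k :=
  ModuleCat.restrictScalars (algebraMap k Aᵐᵒᵖ)

/-! ### Separable Frobenius structures -/

open Functor.LaxMonoidal Functor.OplaxMonoidal in
/-- A separable Frobenius structure on a functor `G` between monoidal categories: a monoidal
structure `(μ, ε)` (written `(G_2, G_0)`, not necessarily invertible) and an opmonoidal structure
`(δ, η)` (written `(G^2, G^0)`) on `G` which satisfy the two Frobenius conditions, and for which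
`G_2 ∘ G^2` is the identity. -/
structure SeparableFrobeniusStructure {C : Type u₁} [Category.{v₁} C] [MonoidalCategory C]
    {M : Type u₂} [Category.{v₂} M] [MonoidalCategory M] (G : C ⥤ M) extends
    G.LaxMonoidal, G.OplaxMonoidal where
  /-- First Frobenius condition, an equality of arrows `GX ⊗ G(Y ⊗ Z) ⟶ G(X ⊗ Y) ⊗ GZ`. -/
  frobenius_left : ∀ X Y Z : C,
    (G.obj X ◁ δ Y Z) ≫ (α_ (G.obj X) (G.obj Y) (G.obj Z)).inv ≫ (μ X Y ▷ G.obj Z) =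
      μ X (Y ⊗ Z) ≫ G.map (α_ X Y Z).inv ≫ δ (X ⊗ Y) Z
  /-- Second Frobenius condition, an equality of arrows `G(X ⊗ Y) ⊗ GZ ⟶ GX ⊗ G(Y ⊗ Z)`. -/
  frobenius_right : ∀ X Y Z : C,
    (δ X Y ▷ G.obj Z) ≫ (α_ (G.obj X) (G.obj Y) (G.obj Z)).hom ≫ (G.obj X ◁ μ Y Z) =
      μ (X ⊗ Y) Z ≫ G.map (α_ X Y Z).hom ≫ δ X (Y ⊗ Z)
  /-- Separability: `G_2 ∘ G^2 = id`. -/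
  separable : ∀ X Y : C, δ X Y ≫ μ X Y = 𝟙 (G.obj (X ⊗ Y))

/-- A functor `G` out of a `k`-linear category `C` *carries a separable Frobenius structure* if
there are a `k`-linear monoidal structure on `C` (one whose tensor product is `k`-bilinear on
arrows) and a separable Frobenius structure on `G` with respect to it. -/
def CarriesSeparableFrobenius (k : Type u) [CommRing k]
    {C : Type u₁} [Category.{v₁} C] [Preadditive C] [CategoryTheory.Linear k C]
    {M : Type u₂} [Category.{v₂} M] [MonoidalCategory M] (G : C ⥤ M) : Prop :=
  ∃ (_ : MonoidalCategory C) (_ : MonoidalPreadditive C) (_ : MonoidalLinear k C),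
    Nonempty (SeparableFrobeniusStructure G)

/-! ### Monadicity and equivalence over a base -/

/-- `G` is monadic: it has a left adjoint `F`, and the comparison functor from its source to the
Eilenberg-Moore category of the monad `GF` is an equivalence. -/
def IsMonadic {C : Type u₁} [Category.{v₁} C] {M : Type u₂} [Category.{v₂} M] (G : C ⥤ M) : Prop :=
  Nonempty (MonadicRightAdjoint G)

/-- The functors `G : C ⥤ M` and `G' : D ⥤ M` out of `k`-linear categories are equivalent as
objects of `k-Cat / M`: there are a `k`-linear equivalence `K : C ≌ D` and a natural isomorphism
`G ≅ G' K`. -/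
def EquivalentOver (k : Type u) [CommRing k]
    {C : Type u₁} [Category.{v₁} C] [Preadditive C] [CategoryTheory.Linear k C]
    {D : Type u₂} [Category.{v₂} D] [Preadditive D] [CategoryTheory.Linear k D]
    {M : Type u₃} [Category.{v₃} M] (G : C ⥤ M) (G' : D ⥤ M) : Prop :=
  ∃ K : C ≌ D, K.functor.Additive ∧ K.functor.Linear k ∧ Nonempty (G ≅ K.functor ⋙ G')

end

/-! ### Right actions -/

/-! Both directions pass through `Realization`: actions of an algebra `A` on the modules `G X` that
identify `C` with the category of right `A`-modules, expressed without leaving `C`. Monadicity makes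
`G` faithful, so equations in `C` can be tested on elements.

From a weak bialgebra to a separable Frobenius functor: `Δ(1)` is idempotent because `Δ` is
multiplicative. The tensor product of `X` and `Y` is the image of `Δ(1)` on `G X ⊗ G Y`; `G^2` is
the inclusion and `G_2` the projection, so separability is built in. By coassociativity both
bracketings of a triple product split the same idempotent `Δ²(1)`, which gives the associator, and
coherence is inherited from `k`-modules along the inclusions. The two factorizations of `Δ²(1)` into
`Δ(1) ⊗ 1` and `1 ⊗ Δ(1)` are exactly the two Frobenius conditions. The unit object is the submodule
of functionals `ε(a -)` in the dual of `A`; its unit constraints rest on the identities for the maps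
`projFst` and `projSnd`. Restriction of scalars has both adjoints and reflects isomorphisms, hence
is monadic by the reflexive form of Beck's theorem (`longForgetful_isMonadic`), and all of this is
transported along the equivalence.

Conversely, let `F ⊣ G ⊣ H`. Elements of `G X` are morphisms `F k ⟶ X`, so `A = G F k` is an algebra
that acts on every `G X`. Because of `H`, a morphism out of `G F N` is determined by its
restrictions along the maps `G F k ⟶ G F N` given by the elements of `N`. Thus algebras over the
monad `G F` are right `A`-modules (`GeneratorAlgebra.nonempty_realization`). If `u` generates the
regular module, put `Δ(a) = G^2((u ⊗ u) a)` and `ε(a) = G^0(1_E a)`, where `u ⊗ u` and `1_E` come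
from `G_2` and `G_0`. Every element of every `G X` is an image of `u`, so naturality expresses the
Frobenius structure on all objects through `Δ` (`RegularObject.δLin_act_μLin`), and each axiom of a
weak bialgebra becomes one coherence or Frobenius equation evaluated at `u` or `1_E`. -/

/-- A right action of a `k`-algebra `A` on a `k`-module `N`. -/
structure RightAction (k A N : Type*) [CommRing k] [Ring A] [Algebra k A] [AddCommGroup N]
    [Module k N] where
  /-- The operators by which the elements of `A` act. -/
  act : A →ₗ[k] N →ₗ[k] N
  act_one : ∀ x : N, act 1 x = x
  act_mul : ∀ (a b : A) (x : N), act (a * b) x = act b (act a x)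

namespace RightAction

variable {k A B M N : Type*} [CommRing k] [Ring A] [Algebra k A] [Ring B] [Algebra k B]
  [AddCommGroup M] [Module k M] [AddCommGroup N] [Module k N]

/-- The operators by which `A ⊗ B` acts on `M ⊗ N`. -/
noncomputable def tensorAct (r : A →ₗ[k] M →ₗ[k] M) (s : B →ₗ[k] N →ₗ[k] N) :
    A ⊗[k] B →ₗ[k] M ⊗[k] N →ₗ[k] M ⊗[k] N :=
  TensorProduct.homTensorHomMap (RingHom.id k) M N M N ∘ₗ TensorProduct.map r s

@[simp]
theorem tensorAct_tmul_tmul (r : A →ₗ[k] M →ₗ[k] M) (s : B →ₗ[k] N →ₗ[k] N) (a : A) (b : B)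
    (x : M) (y : N) : tensorAct r s (a ⊗ₜ b) (x ⊗ₜ y) = r a x ⊗ₜ s b y := by
  simp [tensorAct]

/-- The tensor product of right actions. -/
noncomputable def tensor (r : RightAction k A M) (s : RightAction k B N) :
    RightAction k (A ⊗[k] B) (M ⊗[k] N) where
  act := tensorAct r.act s.act
  act_one x := by
    induction x with
    | zero => simp
    | add x y hx hy => rw [map_add, hx, hy]
    | tmul x y => rw [Algebra.TensorProduct.one_def, tensorAct_tmul_tmul, r.act_one, s.act_one]
  act_mul a b x := by
    induction a with
    | zero => simp
    | add a a' ha ha' => simp only [add_mul, map_add, LinearMap.add_apply, ha, ha']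
    | tmul a a' =>
      induction b with
      | zero => simp
      | add b b' hb hb' => simp only [mul_add, map_add, LinearMap.add_apply, hb, hb']
      | tmul b b' =>
        induction x with
        | zero => simp
        | add x y hx hy => simp only [map_add, hx, hy]
        | tmul x y =>
          simp only [Algebra.TensorProduct.tmul_mul_tmul, tensorAct_tmul_tmul, r.act_mul,
            s.act_mul]

@[simp]
theorem tensor_act_tmul_tmul (r : RightAction k A M) (s : RightAction k B N) (a : A) (b : B)
    (x : M) (y : N) : (r.tensor s).act (a ⊗ₜ b) (x ⊗ₜ y) = r.act a x ⊗ₜ s.act b y :=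
  tensorAct_tmul_tmul _ _ _ _ _ _

end RightAction

/-! ### Identities in weak bialgebras -/

namespace WeakBialgebra

open Coalgebra CoalgebraStruct

section Counit

variable (k A : Type*) [CommRing k] [Ring A] [Algebra k A] [Coalgebra k A]

/-- The map `x ⊗ y ↦ ε(x) y`. -/
noncomputable def counitFst : A ⊗[k] A →ₗ[k] A :=
  (TensorProduct.lid k A).toLinearMap ∘ₗ (counit (R := k) (A := A)).rTensor A

/-- The map `x ⊗ y ↦ ε(y) x`. -/
noncomputable def counitSnd : A ⊗[k] A →ₗ[k] A :=
  (TensorProduct.rid k A).toLinearMap ∘ₗ (counit (R := k) (A := A)).lTensor A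

/-- The map `x ⊗ y ⊗ z ↦ ε(y) x ⊗ z`. -/
noncomputable def counitMid : (A ⊗[k] A) ⊗[k] A →ₗ[k] A ⊗[k] A :=
  (counitSnd k A).rTensor A

variable {A}

@[simp]
theorem counitFst_tmul (x y : A) : counitFst k A (x ⊗ₜ y) = counit (R := k) x • y := by
  simp [counitFst]

@[simp]
theorem counitSnd_tmul (x y : A) : counitSnd k A (x ⊗ₜ y) = counit (R := k) y • x := by
  simp [counitSnd]

@[simp]
theorem counitMid_tmul (x y z : A) :
    counitMid k A ((x ⊗ₜ y) ⊗ₜ z) = (counit (R := k) y • x) ⊗ₜ z := by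
  simp [counitMid]

theorem counitFst_comul (a : A) : counitFst k A (comul a) = a := by
  simp [counitFst]

theorem counitSnd_comul (a : A) : counitSnd k A (comul a) = a := by
  simp [counitSnd]

/-- The middle leg is the second half of a coproduct here and the first half in the next lemma, so
`ε` cancels it by counitality either way. This is how `Δ²(1)` is collapsed to `Δ(1)` below. -/
theorem counitMid_rTensor_comul (s : A ⊗[k] A) :
    counitMid k A (comul.rTensor A s) = s := by
  induction s with
  | zero => simp
  | add x y hx hy => rw [map_add, map_add, hx, hy]
  | tmul x y => simp [counitMid, counitSnd_comul]

theorem counitMid_lTensor_comul (s : A ⊗[k] A) :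
    counitMid k A ((TensorProduct.assoc k A A A).symm (comul.lTensor A s)) = s := by
  have h (x : A) (t : A ⊗[k] A) : counitMid k A ((TensorProduct.assoc k A A A).symm (x ⊗ₜ t)) =
      x ⊗ₜ counitFst k A t := by
    induction t with
    | zero => simp
    | add y z hy hz => simp only [TensorProduct.tmul_add, map_add, hy, hz]
    | tmul y z => simp [TensorProduct.smul_tmul]
  induction s with
  | zero => simp
  | add x y hx hy => rw [map_add, map_add, map_add, hx, hy]
  | tmul x y => rw [LinearMap.lTensor_tmul, h, counitFst_comul]

end Counit

variable (k : Type*) {A : Type*} [CommRing k] [Ring A] [Algebra k A] [WeakBialgebra k A]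

theorem comul_mul_comul_one (a : A) : comul (R := k) a * comul (R := k) (1 : A) = comul a := by
  rw [← comul_mul, mul_one]

theorem comul_one_mul_comul (a : A) : comul (R := k) (1 : A) * comul (R := k) a = comul a := by
  rw [← comul_mul, one_mul]

variable (A) in
/-- The map `a ↦ ε(a 1₁) 1₂`. -/
noncomputable def projFst : A →ₗ[k] A :=
  counitFst k A ∘ₗ LinearMap.mulRight k (comul 1) ∘ₗ (TensorProduct.mk k A A).flip 1

theorem projFst_apply (a : A) : projFst k A a = counitFst k A (a ⊗ₜ 1 * comul 1) := rfl

variable (A) in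
/-- The map `a ↦ 1₁ ε(a 1₂)`. -/
noncomputable def projSnd : A →ₗ[k] A :=
  counitSnd k A ∘ₗ LinearMap.mulRight k (comul 1) ∘ₗ TensorProduct.mk k A A 1

theorem projSnd_apply (a : A) : projSnd k A a = counitSnd k A (1 ⊗ₜ a * comul 1) := rfl

/-- Weak multiplicativity of `ε` with middle factor `1`. It makes the projection invisible to the
functional `ε(a -)`, hence to the unit object. -/
theorem counit_projFst_mul (a b : A) :
    counit (R := k) (projFst k A a * b) = counit (R := k) (a * b) := by
  have h (s : A ⊗[k] A) : counit (R := k) (counitFst k A (a ⊗ₜ 1 * s) * b) =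
      LinearMap.mul' k k (TensorProduct.map
        (counit ∘ₗ LinearMap.mulLeft k a) (counit ∘ₗ LinearMap.mulRight k b) s) := by
    induction s with
    | zero => simp
    | add x y hx hy => simp only [map_add, add_mul, mul_add, hx, hy]
    | tmul x y => simp
  rw [projFst_apply, h, ← counit_mul_mul, mul_one]

theorem counit_projSnd_mul (a b : A) :
    counit (R := k) (projSnd k A a * b) = counit (R := k) (a * b) := by
  have h (s : A ⊗[k] A) : counit (R := k) (counitSnd k A (1 ⊗ₜ a * s) * b) =
      LinearMap.mul' k k (TensorProduct.map
        (counit ∘ₗ LinearMap.mulRight k b) (counit ∘ₗ LinearMap.mulLeft k a) s) := by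
    induction s with
    | zero => simp
    | add x y hx hy => simp only [map_add, add_mul, mul_add, hx, hy]
    | tmul x y => simp [mul_comm]
  rw [projSnd_apply, h, ← counit_mul_mul', mul_one]

/-- Coassociativity turns `1₁ ⊗ Δ(1₂)` into `Δ²(1) = (Δ(1) ⊗ 1)(1 ⊗ Δ(1))`; applying `ε(a -)` to the
first leg then affects only the first factor. The mirror statement below uses the other order of the
factors. -/
theorem comul_projFst (a : A) :
    comul (R := k) (projFst k A a) = (projFst k A a ⊗ₜ[k] (1 : A)) * comul (R := k) (1 : A) := by
  let φ : A ⊗[k] (A ⊗[k] A) →ₗ[k] A ⊗[k] A := (TensorProduct.lid k _).toLinearMap ∘ₗ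
    ((counit (R := k) (A := A)) ∘ₗ LinearMap.mulLeft k a).rTensor _
  have h (s : A ⊗[k] A) : comul (R := k) (counitFst k A (a ⊗ₜ 1 * s)) = φ (comul.lTensor A s) := by
    induction s with
    | zero => simp
    | add x y hx hy => simp only [map_add, mul_add, hx, hy]
    | tmul x y => simp [φ]
  have h' (s t : A ⊗[k] A) : φ (TensorProduct.assoc k A A A ((s ⊗ₜ[k] (1 : A)) *
      (TensorProduct.assoc k A A A).symm ((1 : A) ⊗ₜ[k] t))) =
      (counitFst k A (a ⊗ₜ 1 * s) ⊗ₜ[k] (1 : A)) * t := by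
    induction s with
    | zero => simp
    | add x y hx hy => simp only [map_add, add_mul, mul_add, TensorProduct.add_tmul, hx, hy]
    | tmul x y =>
      induction t with
      | zero => simp
      | add x y hx hy => simp only [map_add, mul_add, TensorProduct.tmul_add, hx, hy]
      | tmul z w => simp [φ, TensorProduct.smul_tmul']
  rw [projFst_apply, h, ← coassoc_apply, comul_comul_one, h']

theorem comul_projSnd (a : A) :
    comul (R := k) (projSnd k A a) = ((1 : A) ⊗ₜ[k] projSnd k A a) * comul (R := k) (1 : A) := by
  let φ : (A ⊗[k] A) ⊗[k] A →ₗ[k] A ⊗[k] A := (TensorProduct.rid k _).toLinearMap ∘ₗ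
    ((counit (R := k) (A := A)) ∘ₗ LinearMap.mulLeft k a).lTensor _
  have h (s : A ⊗[k] A) : comul (R := k) (counitSnd k A (1 ⊗ₜ a * s)) = φ (comul.rTensor A s) := by
    induction s with
    | zero => simp
    | add x y hx hy => simp only [map_add, mul_add, hx, hy]
    | tmul x y => simp [φ]
  have h' (s t : A ⊗[k] A) : φ ((TensorProduct.assoc k A A A).symm ((1 : A) ⊗ₜ[k] t) *
      (s ⊗ₜ[k] (1 : A))) = ((1 : A) ⊗ₜ[k] counitSnd k A (1 ⊗ₜ a * t)) * s := by
    induction s with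
    | zero => simp
    | add x y hx hy => simp only [map_add, mul_add, TensorProduct.add_tmul, hx, hy]
    | tmul x y =>
      induction t with
      | zero => simp
      | add x y hx hy => simp only [map_add, add_mul, mul_add, TensorProduct.tmul_add, hx, hy]
      | tmul z w => simp [φ, TensorProduct.tmul_smul]
  rw [projSnd_apply, h, comul_comul_one', h']

/-- Write `Δ(b) = Δ(b)Δ(1)`. With the `Δ(1)` hidden in `projSnd` this creates the factor `(1 ⊗
Δ(1))(Δ(1) ⊗ 1) = Δ²(1)`, so the left side is `ε` on the middle leg of `(1 ⊗ Δ(b))Δ²(1) = (id ⊗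
Δ)((1 ⊗ b)Δ(1))`, and counitality applies. This identity and its mirror make the unit constraints
`A`-linear. -/
theorem rTensor_projSnd_comul (b : A) :
    (projSnd k A).rTensor A (comul b) = ((1 : A) ⊗ₜ[k] b) * comul (R := k) (1 : A) := by
  have h (u s t : A ⊗[k] A) :
      (counitSnd k A ∘ₗ LinearMap.mulRight k t ∘ₗ TensorProduct.mk k A A 1).rTensor A (u * s) =
      counitMid k A ((TensorProduct.assoc k A A A).symm (1 ⊗ₜ u) *
        ((TensorProduct.assoc k A A A).symm (1 ⊗ₜ s) * (t ⊗ₜ 1))) := by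
    induction u with
    | zero => simp
    | add x y hx hy => simp only [map_add, add_mul, TensorProduct.tmul_add, hx, hy]
    | tmul p q =>
      induction s with
      | zero => simp
      | add x y hx hy => simp only [map_add, add_mul, mul_add, TensorProduct.tmul_add, hx, hy]
      | tmul a b =>
        induction t with
        | zero => simp
        | add x y hx hy =>
          simp only [TensorProduct.add_tmul, mul_add, map_add, ← hx, ← hy]
          simp [mul_add, TensorProduct.add_tmul]
        | tmul c d => simp [mul_assoc]
  have h' (s : A ⊗[k] A) : (1 : A) ⊗ₜ[k] comul (R := k) b * comul.lTensor A s =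
      comul.lTensor A (1 ⊗ₜ b * s) := by
    induction s with
    | zero => simp
    | add x y hx hy => simp only [map_add, mul_add, hx, hy]
    | tmul x y => simp [comul_mul]
  have h'' (s t : A ⊗[k] (A ⊗[k] A)) : (TensorProduct.assoc k A A A).symm s *
      (TensorProduct.assoc k A A A).symm t = (TensorProduct.assoc k A A A).symm (s * t) :=
    (map_mul (Algebra.TensorProduct.assoc k k k A A A).symm s t).symm
  have e : comul.rTensor A (comul (R := k) (1 : A)) =
      (TensorProduct.assoc k A A A).symm (comul.lTensor A (comul 1)) := by
    rw [LinearEquiv.eq_symm_apply, coassoc_apply]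
  have := h (comul b) (comul 1) (comul 1)
  rw [comul_mul_comul_one, ← comul_comul_one', e, h'', h', counitMid_lTensor_comul] at this
  exact this

theorem lTensor_projFst_comul (b : A) :
    (projFst k A).lTensor A (comul b) = (b ⊗ₜ[k] (1 : A)) * comul (R := k) (1 : A) := by
  have h (u s t : A ⊗[k] A) :
      (counitFst k A ∘ₗ LinearMap.mulRight k t ∘ₗ (TensorProduct.mk k A A).flip 1).lTensor A
        (u * s) = counitMid k A ((u ⊗ₜ 1) *
        ((s ⊗ₜ 1) * (TensorProduct.assoc k A A A).symm (1 ⊗ₜ t))) := by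
    induction u with
    | zero => simp
    | add x y hx hy => simp only [map_add, add_mul, TensorProduct.add_tmul, hx, hy]
    | tmul p q =>
      induction s with
      | zero => simp
      | add x y hx hy => simp only [map_add, add_mul, mul_add, TensorProduct.add_tmul, hx, hy]
      | tmul a b =>
        induction t with
        | zero => simp
        | add x y hx hy =>
          simp only [TensorProduct.tmul_add, mul_add, map_add, ← hx, ← hy]
          simp [mul_add, TensorProduct.tmul_add]
        | tmul c d => simp [mul_assoc, TensorProduct.smul_tmul]
  have h' (s : A ⊗[k] A) : comul (R := k) b ⊗ₜ[k] (1 : A) * comul.rTensor A s =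
      comul.rTensor A (b ⊗ₜ 1 * s) := by
    induction s with
    | zero => simp
    | add x y hx hy => simp only [map_add, mul_add, hx, hy]
    | tmul x y => simp [comul_mul]
  have := h (comul b) (comul 1) (comul 1)
  rw [comul_mul_comul_one, ← comul_comul_one, h', counitMid_rTensor_comul] at this
  exact this

end WeakBialgebra

/-! ### Split tensor products along a functor -/

/-- Tensor products, together with associativity and unit isomorphisms, on the source of a functor
`G` to a monoidal category, such that `G (X ⊗ Y)` is a retract of `G X ⊗ G Y` and the structure
morphisms are determined by those of the target. -/
structure SplitTensor {C : Type u₁} [Category.{v₁} C] {M : Type u₂} [Category.{v₂} M]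
    [MonoidalCategory M] (G : C ⥤ M) where
  /-- The tensor product of two objects. -/
  obj : C → C → C
  /-- The tensor product of two morphisms. -/
  hom : ∀ {X Y X' Y' : C}, (X ⟶ Y) → (X' ⟶ Y') → (obj X X' ⟶ obj Y Y')
  /-- The inclusion. -/
  δ : ∀ X Y : C, G.obj (obj X Y) ⟶ G.obj X ⊗ G.obj Y
  /-- The projection. -/
  μ : ∀ X Y : C, G.obj X ⊗ G.obj Y ⟶ G.obj (obj X Y)
  δ_μ : ∀ X Y : C, δ X Y ≫ μ X Y = 𝟙 _
  map_hom_δ : ∀ {X Y X' Y' : C} (f : X ⟶ Y) (g : X' ⟶ Y'),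
    G.map (hom f g) ≫ δ Y Y' = δ X X' ≫ (G.map f ⊗ₘ G.map g)
  μ_map_hom : ∀ {X Y X' Y' : C} (f : X ⟶ Y) (g : X' ⟶ Y'),
    (G.map f ⊗ₘ G.map g) ≫ μ Y Y' = μ X X' ≫ G.map (hom f g)
  /-- The associativity isomorphism. -/
  assoc : ∀ X Y Z : C, obj (obj X Y) Z ≅ obj X (obj Y Z)
  map_assoc_δ : ∀ X Y Z : C, G.map (assoc X Y Z).hom ≫ δ X (obj Y Z) ≫ G.obj X ◁ δ Y Z =
    δ (obj X Y) Z ≫ δ X Y ▷ G.obj Z ≫ (α_ (G.obj X) (G.obj Y) (G.obj Z)).hom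
  μ_map_assoc : ∀ X Y Z : C, μ X Y ▷ G.obj Z ≫ μ (obj X Y) Z ≫ G.map (assoc X Y Z).hom =
    (α_ (G.obj X) (G.obj Y) (G.obj Z)).hom ≫ G.obj X ◁ μ Y Z ≫ μ X (obj Y Z)
  frobenius_left : ∀ X Y Z : C,
    (G.obj X ◁ δ Y Z) ≫ (α_ (G.obj X) (G.obj Y) (G.obj Z)).inv ≫ (μ X Y ▷ G.obj Z) =
      μ X (obj Y Z) ≫ G.map (assoc X Y Z).inv ≫ δ (obj X Y) Z
  frobenius_right : ∀ X Y Z : C,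
    (δ X Y ▷ G.obj Z) ≫ (α_ (G.obj X) (G.obj Y) (G.obj Z)).hom ≫ (G.obj X ◁ μ Y Z) =
      μ (obj X Y) Z ≫ G.map (assoc X Y Z).hom ≫ δ X (obj Y Z)
  /-- The unit object. -/
  unit : C
  /-- The counit morphism. -/
  η : G.obj unit ⟶ 𝟙_ M
  /-- The unit morphism. -/
  ε : 𝟙_ M ⟶ G.obj unit
  /-- The left unit isomorphism. -/
  leftUnitor : ∀ X : C, obj unit X ≅ X
  map_leftUnitor : ∀ X : C, G.map (leftUnitor X).hom =
    δ unit X ≫ η ▷ G.obj X ≫ (λ_ (G.obj X)).hom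
  ε_leftUnitor : ∀ X : C, ε ▷ G.obj X ≫ μ unit X ≫ G.map (leftUnitor X).hom = (λ_ (G.obj X)).hom
  /-- The right unit isomorphism. -/
  rightUnitor : ∀ X : C, obj X unit ≅ X
  map_rightUnitor : ∀ X : C, G.map (rightUnitor X).hom =
    δ X unit ≫ G.obj X ◁ η ≫ (ρ_ (G.obj X)).hom
  ε_rightUnitor : ∀ X : C, G.obj X ◁ ε ≫ μ X unit ≫ G.map (rightUnitor X).hom = (ρ_ (G.obj X)).hom

namespace SplitTensor

variable {C : Type u₁} [Category.{v₁} C] {M : Type u₂} [Category.{v₂} M]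
    [MonoidalCategory M] {G : C ⥤ M} (S : SplitTensor G)

theorem mono_δ (X Y : C) : Mono (S.δ X Y) := mono_of_mono_fac (S.δ_μ X Y)

theorem mono_whiskerLeft_δ (W : M) (X Y : C) : Mono (W ◁ S.δ X Y) :=
  mono_of_mono_fac (h := 𝟙 _) (g := W ◁ S.δ X Y) (f := W ◁ S.μ X Y) (by
    rw [← MonoidalCategory.whiskerLeft_comp, S.δ_μ, MonoidalCategory.whiskerLeft_id])

theorem mono_whiskerLeft_whiskerLeft_δ (V W : M) (X Y : C) : Mono (V ◁ W ◁ S.δ X Y) :=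
  mono_of_mono_fac (h := 𝟙 _) (g := V ◁ W ◁ S.δ X Y) (f := V ◁ W ◁ S.μ X Y) (by
    rw [← MonoidalCategory.whiskerLeft_comp, ← MonoidalCategory.whiskerLeft_comp, S.δ_μ,
      MonoidalCategory.whiskerLeft_id, MonoidalCategory.whiskerLeft_id])

theorem map_id_hom_δ (X : C) {Y Z : C} (f : Y ⟶ Z) :
    G.map (S.hom (𝟙 X) f) ≫ S.δ X Z = S.δ X Y ≫ G.obj X ◁ G.map f := by
  rw [S.map_hom_δ, G.map_id, id_tensorHom]

theorem map_hom_id_δ {X Y : C} (f : X ⟶ Y) (Z : C) :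
    G.map (S.hom f (𝟙 Z)) ≫ S.δ Y Z = S.δ X Z ≫ G.map f ▷ G.obj Z := by
  rw [S.map_hom_δ, G.map_id, tensorHom_id]

/-- `δ` is a split monomorphism and `G` is faithful, so arrows into a tensor product can be compared
in `M`; the versions for more factors iterate this. -/
theorem hom_ext [G.Faithful] {W X Y : C} {f g : W ⟶ S.obj X Y}
    (h : G.map f ≫ S.δ X Y = G.map g ≫ S.δ X Y) : f = g := by
  have := S.mono_δ X Y
  exact G.map_injective ((cancel_mono _).1 h)

theorem hom_ext₃ [G.Faithful] {W X Y Z : C} {f g : W ⟶ S.obj X (S.obj Y Z)}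
    (h : G.map f ≫ S.δ X (S.obj Y Z) ≫ G.obj X ◁ S.δ Y Z =
      G.map g ≫ S.δ X (S.obj Y Z) ≫ G.obj X ◁ S.δ Y Z) : f = g := by
  have := S.mono_whiskerLeft_δ (G.obj X) Y Z
  refine S.hom_ext ((cancel_mono (G.obj X ◁ S.δ Y Z)).1 ?_)
  simpa only [Category.assoc] using h

theorem hom_ext₄ [G.Faithful] {V W X Y Z : C} {f g : V ⟶ S.obj W (S.obj X (S.obj Y Z))}
    (h : G.map f ≫ S.δ W _ ≫ G.obj W ◁ (S.δ X _ ≫ G.obj X ◁ S.δ Y Z) =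
      G.map g ≫ S.δ W _ ≫ G.obj W ◁ (S.δ X _ ≫ G.obj X ◁ S.δ Y Z)) : f = g := by
  have := S.mono_whiskerLeft_whiskerLeft_δ (G.obj W) (G.obj X) Y Z
  refine S.hom_ext₃ ((cancel_mono (G.obj W ◁ G.obj X ◁ S.δ Y Z)).1 ?_)
  simpa only [Category.assoc, MonoidalCategory.whiskerLeft_comp] using h

/-- After the iterated inclusion into the fourfold tensor product of `M`, every associator of `C`
becomes one of `M`, so the pentagon of `M` suffices. -/
theorem pentagon [G.Faithful] (W X Y Z : C) :
    S.hom (S.assoc W X Y).hom (𝟙 Z) ≫ (S.assoc W (S.obj X Y) Z).hom ≫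
      S.hom (𝟙 W) (S.assoc X Y Z).hom =
    (S.assoc (S.obj W X) Y Z).hom ≫ (S.assoc W X (S.obj Y Z)).hom := by
  apply S.hom_ext₄
  have e₁ := S.map_id_hom_δ W (S.assoc X Y Z).hom
  have e₂ := S.map_assoc_δ W (S.obj X Y) Z
  have e₃ := S.map_hom_id_δ (S.assoc W X Y).hom Z
  have e₄ := S.map_assoc_δ (S.obj W X) Y Z
  have e₅ := S.map_assoc_δ W X (S.obj Y Z)
  simp only [Functor.map_comp, Category.assoc]
  rw [reassoc_of% e₁, ← MonoidalCategory.whiskerLeft_comp, S.map_assoc_δ X Y Z,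
    MonoidalCategory.whiskerLeft_comp, MonoidalCategory.whiskerLeft_comp, reassoc_of% e₂,
    reassoc_of% e₃, MonoidalCategory.whiskerLeft_comp, reassoc_of% e₅]
  rw [← associator_naturality_middle_assoc, ← comp_whiskerRight_assoc, ← comp_whiskerRight_assoc,
    Category.assoc, S.map_assoc_δ W X Y]
  rw [← associator_naturality_right, ← whisker_exchange_assoc, reassoc_of% e₄]
  simp

theorem triangle [G.Faithful] (X Y : C) :
    (S.assoc X S.unit Y).hom ≫ S.hom (𝟙 X) (S.leftUnitor Y).hom =
      S.hom (S.rightUnitor X).hom (𝟙 Y) := by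
  apply S.hom_ext
  have e := S.map_assoc_δ X S.unit Y
  rw [Functor.map_comp, Category.assoc, map_id_hom_δ, map_hom_id_δ, S.map_leftUnitor,
    S.map_rightUnitor, MonoidalCategory.whiskerLeft_comp, reassoc_of% e]
  simp

theorem assoc_naturality [G.Faithful] {X₁ X₂ X₃ Y₁ Y₂ Y₃ : C} (f₁ : X₁ ⟶ Y₁) (f₂ : X₂ ⟶ Y₂)
    (f₃ : X₃ ⟶ Y₃) : S.hom (S.hom f₁ f₂) f₃ ≫ (S.assoc Y₁ Y₂ Y₃).hom =
      (S.assoc X₁ X₂ X₃).hom ≫ S.hom f₁ (S.hom f₂ f₃) := by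
  apply S.hom_ext₃
  have e₁ := S.map_hom_δ (S.hom f₁ f₂) f₃
  have e₂ := S.map_hom_δ f₁ (S.hom f₂ f₃)
  have e₃ := S.map_assoc_δ X₁ X₂ X₃
  simp only [Functor.map_comp, Category.assoc]
  rw [S.map_assoc_δ, reassoc_of% e₁, reassoc_of% e₂]
  rw [← id_tensorHom, tensorHom_comp_tensorHom, S.map_hom_δ, Category.comp_id,
    ← tensorHom_id, tensorHom_comp_tensorHom_assoc, S.map_hom_δ, Category.comp_id]
  conv_lhs => rw [← Category.id_comp (G.map f₃), ← tensorHom_comp_tensorHom]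
  conv_rhs => rw [← Category.id_comp (G.map f₁), ← tensorHom_comp_tensorHom]
  rw [id_tensorHom, reassoc_of% e₃, tensorHom_id, Category.assoc, associator_naturality]

theorem leftUnitor_naturality [G.Faithful] {X Y : C} (f : X ⟶ Y) :
    S.hom (𝟙 S.unit) f ≫ (S.leftUnitor Y).hom = (S.leftUnitor X).hom ≫ f := by
  apply G.map_injective
  have e := S.map_id_hom_δ S.unit f
  rw [Functor.map_comp, Functor.map_comp, S.map_leftUnitor, S.map_leftUnitor, reassoc_of% e]
  simp [whisker_exchange_assoc]

theorem rightUnitor_naturality [G.Faithful] {X Y : C} (f : X ⟶ Y) :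
    S.hom f (𝟙 S.unit) ≫ (S.rightUnitor Y).hom = (S.rightUnitor X).hom ≫ f := by
  apply G.map_injective
  have e := S.map_hom_id_δ f S.unit
  rw [Functor.map_comp, Functor.map_comp, S.map_rightUnitor, S.map_rightUnitor, reassoc_of% e]
  simp [← whisker_exchange_assoc]

/-- The monoidal structure defined by a split tensor product. -/
abbrev monoidalCategory [G.Faithful] : MonoidalCategory C :=
  letI : MonoidalCategoryStruct C :=
    { tensorObj := S.obj
      whiskerLeft := fun X _ _ f => S.hom (𝟙 X) f
      whiskerRight := fun f Y => S.hom f (𝟙 Y)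
      tensorHom := S.hom
      tensorUnit := S.unit
      associator := S.assoc
      leftUnitor := S.leftUnitor
      rightUnitor := S.rightUnitor }
  MonoidalCategory.ofTensorHom
    (id_tensorHom_id := fun X Y => S.hom_ext (by
      change G.map (S.hom _ _) ≫ _ = G.map (𝟙 (S.obj X Y)) ≫ _
      rw [map_id_hom_δ]; simp))
    (id_tensorHom := fun _ _ _ _ => rfl)
    (tensorHom_id := fun _ _ => rfl)
    (tensorHom_comp_tensorHom := fun f₁ f₂ g₁ g₂ => S.hom_ext (by
      change G.map (S.hom _ _ ≫ S.hom _ _) ≫ _ = G.map (S.hom _ _) ≫ _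
      have e := S.map_hom_δ f₁ f₂
      simp only [Functor.map_comp, Category.assoc, S.map_hom_δ]
      rw [reassoc_of% e, tensorHom_comp_tensorHom]))
    (associator_naturality := S.assoc_naturality)
    (leftUnitor_naturality := S.leftUnitor_naturality)
    (rightUnitor_naturality := S.rightUnitor_naturality)
    (pentagon := S.pentagon)
    (triangle := S.triangle)

/-- The separable Frobenius structure defined by a split tensor product. -/
def separableFrobeniusStructure [G.Faithful] :
    letI := S.monoidalCategory
    SeparableFrobeniusStructure G :=
  letI := S.monoidalCategory
  { ε := S.ε
    μ := S.μ
    μ_natural_left := fun f Z => by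
      have := S.μ_map_hom f (𝟙 Z)
      rw [G.map_id, tensorHom_id] at this
      exact this
    μ_natural_right := fun Z f => by
      have := S.μ_map_hom (𝟙 Z) f
      rw [G.map_id, id_tensorHom] at this
      exact this
    associativity := S.μ_map_assoc
    left_unitality := fun X => (S.ε_leftUnitor X).symm
    right_unitality := fun X => (S.ε_rightUnitor X).symm
    η := S.η
    δ := S.δ
    δ_natural_left := fun f Z => (S.map_hom_id_δ f Z).symm
    δ_natural_right := fun Z f => (S.map_id_hom_δ Z f).symm
    oplax_associativity := fun X Y Z => (S.map_assoc_δ X Y Z).symm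
    oplax_left_unitality := fun X => by
      rw [← cancel_mono (λ_ (G.obj X)).hom, Iso.inv_hom_id, Category.assoc, Category.assoc,
        show S.δ (𝟙_ C) X ≫ S.η ▷ G.obj X ≫ (λ_ (G.obj X)).hom = G.map (λ_ X).hom from
          (S.map_leftUnitor X).symm, ← G.map_comp, Iso.inv_hom_id, G.map_id]
    oplax_right_unitality := fun X => by
      rw [← cancel_mono (ρ_ (G.obj X)).hom, Iso.inv_hom_id, Category.assoc, Category.assoc,
        show S.δ X (𝟙_ C) ≫ G.obj X ◁ S.η ≫ (ρ_ (G.obj X)).hom = G.map (ρ_ X).hom from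
          (S.map_rightUnitor X).symm, ← G.map_comp, Iso.inv_hom_id, G.map_id]
    frobenius_left := S.frobenius_left
    frobenius_right := S.frobenius_right
    separable := S.δ_μ }

/-- Separability gives `G(X ◁ f) = δ ≫ (G X ◁ G f) ≫ μ`, which is linear in `f`; faithfulness of `G`
reflects this to `C`. -/
theorem carriesSeparableFrobenius (k : Type u) [CommRing k] [Preadditive C]
    [CategoryTheory.Linear k C] [Preadditive M] [CategoryTheory.Linear k M]
    [MonoidalPreadditive M] [MonoidalLinear k M] [G.Faithful] [G.Additive] [G.Linear k]
    (S : SplitTensor G) : CarriesSeparableFrobenius k G := by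
  let _ := S.monoidalCategory
  have hl (X : C) {Y Z : C} (f : Y ⟶ Z) : G.map (X ◁ f) = S.δ X Y ≫ G.obj X ◁ G.map f ≫ S.μ X Z := by
    have e := S.map_id_hom_δ X f
    change G.map (S.hom (𝟙 X) f) = _
    rw [← reassoc_of% e, S.δ_μ, Category.comp_id]
  have hr {Y Z : C} (f : Y ⟶ Z) (X : C) : G.map (f ▷ X) = S.δ Y X ≫ G.map f ▷ G.obj X ≫ S.μ Z X := by
    have e := S.map_hom_id_δ f X
    change G.map (S.hom f (𝟙 X)) = _
    rw [← reassoc_of% e, S.δ_μ, Category.comp_id]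
  have : MonoidalPreadditive C :=
    { whiskerLeft_zero := fun {X Y Z} => G.map_injective (by simp [hl])
      zero_whiskerRight := fun {X Y Z} => G.map_injective (by simp [hr])
      whiskerLeft_add := fun {X Y Z} f g => G.map_injective (by simp [hl])
      add_whiskerRight := fun {X Y Z} f g => G.map_injective (by simp [hr]) }
  exact ⟨S.monoidalCategory, this,
    { whiskerLeft_smul := fun X _ _ r f => G.map_injective (by simp [hl, Functor.map_smul])
      smul_whiskerRight := fun r _ _ f X => G.map_injective (by simp [hr, Functor.map_smul]) },
    ⟨S.separableFrobeniusStructure⟩⟩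

end SplitTensor

/-! ### Functors that realize the modules over an algebra -/

/-- A functor `G` to `k`-modules whose values are acted upon by a `k`-algebra `A`, in such a way
that its source is identified with the category of right `A`-modules when `G` is faithful. -/
structure Realization (k A : Type u) [CommRing k] [Ring A] [Algebra k A] {C : Type u₁}
    [Category.{v₁} C] (G : C ⥤ ModuleCat.{u} k) where
  /-- The right action on the value at an object. -/
  act : ∀ X : C, RightAction k A (G.obj X)
  map_act : ∀ {X Y : C} (f : X ⟶ Y) (a : A) (x : G.obj X),
    (G.map f).hom ((act X).act a x) = (act Y).act a ((G.map f).hom x)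
  exists_map_eq : ∀ {X Y : C} (φ : G.obj X →ₗ[k] G.obj Y),
    (∀ a x, φ ((act X).act a x) = (act Y).act a (φ x)) → ∃ f : X ⟶ Y, (G.map f).hom = φ
  exists_equiv : ∀ (N : Type u) [AddCommGroup N] [Module k N] (r : RightAction k A N),
    ∃ (X : C) (e : G.obj X ≃ₗ[k] N), ∀ a x, e ((act X).act a x) = r.act a (e x)

namespace Realization

variable {k A : Type u} [CommRing k] [Ring A] [Algebra k A] {C : Type u₁}
    [Category.{v₁} C] {G : C ⥤ ModuleCat.{u} k} (R : Realization k A G)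

theorem exists_iso [G.Faithful] {X Y : C} (φ : G.obj X ≃ₗ[k] G.obj Y)
    (h : ∀ a x, φ ((R.act X).act a x) = (R.act Y).act a (φ x)) :
    ∃ e : X ≅ Y, (G.map e.hom).hom = φ.toLinearMap ∧ (G.map e.inv).hom = φ.symm.toLinearMap := by
  obtain ⟨f, hf⟩ := R.exists_map_eq φ.toLinearMap h
  obtain ⟨g, hg⟩ := R.exists_map_eq φ.symm.toLinearMap (fun a x => by
    apply φ.injective
    have := h a (φ.symm x)
    simp only [LinearEquiv.coe_coe, LinearEquiv.apply_symm_apply] at this ⊢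
    exact this.symm)
  refine ⟨⟨f, g, G.map_injective ?_, G.map_injective ?_⟩, hf, hg⟩
  · ext x
    simp [hf, hg]
  · ext x
    simp [hf, hg]

end Realization

/-! ### The tensor product of modules over a weak bialgebra -/

namespace WeakBialgebra

open CoalgebraStruct

section Corner

variable {k A N : Type*} [CommRing k] [Ring A] [Algebra k A] [WeakBialgebra k A]
  [AddCommGroup N] [Module k N] (r : RightAction k (A ⊗[k] A) N)

theorem act_comul_one_act_comul (a : A) (x : N) :
    r.act (comul 1) (r.act (comul (R := k) a) x) = r.act (comul (R := k) a) x := by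
  rw [← r.act_mul, comul_mul_comul_one]

theorem act_comul_act_comul_one (a : A) (x : N) :
    r.act (comul a) (r.act (comul (R := k) (1 : A)) x) = r.act (comul (R := k) a) x := by
  rw [← r.act_mul, comul_one_mul_comul]

/-- The action of `A` on the image of `Δ(1)`. -/
def cornerAction : RightAction k A (LinearMap.range (r.act (comul (R := k) (1 : A)))) where
  act := LinearMap.mk₂ k (fun a x => ⟨r.act (comul a) x, r.act (comul a) x,
      act_comul_one_act_comul r a x⟩)
    (fun a b x => by ext; simp) (fun c a x => by ext; simp)
    (fun a x y => by ext; simp) (fun c a x => by ext; simp)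
  -- The unit acts as `Δ(1)`, which is not the identity of `N` but is the identity on its own image.
  act_one := by
    rintro ⟨_, x, rfl⟩
    ext
    exact act_comul_one_act_comul r 1 x
  act_mul a b x := by
    ext
    simp [comul_mul, r.act_mul]

end Corner

variable {k A : Type u} [CommRing k] [Ring A] [Algebra k A] [WeakBialgebra k A] {C : Type u₁}
    [Category.{v₁} C] {G : C ⥤ ModuleCat.{u} k}

/-- Objects that realize the images of `Δ(1)` on tensor products. -/
structure TensorObjects (R : Realization k A G) where
  /-- The tensor product of two objects. -/
  obj : C → C → C
  /-- The inclusion. -/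
  δ : ∀ X Y : C, G.obj (obj X Y) →ₗ[k] G.obj X ⊗[k] G.obj Y
  /-- The projection. -/
  μ : ∀ X Y : C, G.obj X ⊗[k] G.obj Y →ₗ[k] G.obj (obj X Y)
  μ_δ : ∀ (X Y : C) (w : G.obj (obj X Y)), μ X Y (δ X Y w) = w
  δ_μ : ∀ (X Y : C) (t : G.obj X ⊗[k] G.obj Y),
    δ X Y (μ X Y t) = ((R.act X).tensor (R.act Y)).act (comul 1) t
  δ_act : ∀ (X Y : C) (a : A) (w : G.obj (obj X Y)), δ X Y ((R.act (obj X Y)).act a w) =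
    ((R.act X).tensor (R.act Y)).act (comul a) (δ X Y w)

/-- The realizing object of the corner action serves as the product: `δ` is the inclusion of the
image of `Δ(1)`, and `μ` is `Δ(1)` corestricted to its image. -/
theorem nonempty_tensorObjects (R : Realization k A G) : Nonempty (TensorObjects R) := by
  choose T e h using fun X Y : C =>
    R.exists_equiv _ (cornerAction ((R.act X).tensor (R.act Y)))
  refine ⟨⟨T, fun X Y => Submodule.subtype _ ∘ₗ (e X Y).toLinearMap,
    fun X Y => (e X Y).symm.toLinearMap ∘ₗ LinearMap.rangeRestrict _, fun X Y w => ?_,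
    fun X Y t => ?_, fun X Y a w => ?_⟩⟩
  · have : LinearMap.rangeRestrict (((R.act X).tensor (R.act Y)).act (comul 1))
        ((e X Y w : _) : G.obj X ⊗[k] G.obj Y) = e X Y w := by
      obtain ⟨y, hy⟩ := (e X Y w).2
      ext
      change (((R.act X).tensor (R.act Y)).act (comul 1)) ((e X Y w : _) : _) = _
      rw [← hy, act_comul_one_act_comul]
    simp [this]
  · simp
  · simp only [LinearMap.comp_apply, LinearEquiv.coe_coe, h]
    rfl

/-- An object that realizes the image of the counit under the action of `A` on its dual. -/
structure UnitObject (R : Realization k A G) where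
  /-- The object. -/
  obj : C
  /-- The action of `A` on the generator. -/
  q : A →ₗ[k] G.obj obj
  /-- The evaluation at `1`. -/
  η : G.obj obj →ₗ[k] k
  surjective : Function.Surjective q
  q_mul : ∀ a b : A, q (a * b) = (R.act obj).act b (q a)
  η_q : ∀ a : A, η (q a) = counit a
  q_projFst_mul : ∀ a b : A, q (projFst k A a * b) = q (a * b)
  q_projSnd : ∀ a : A, q (projSnd k A a) = q a

variable (k A) in
/-- The map `a ↦ ε(a -)`. -/
def counitMul : A →ₗ[k] Module.Dual k A :=
  (LinearMap.mul k A).compr₂ (counit (R := k) (A := A))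

theorem counitMul_apply (a b : A) : counitMul k A a b = counit (a * b) := rfl

variable (k A) in
/-- The action of `A` on the image of the counit in its dual. -/
def counitAction : RightAction k A (LinearMap.range (counitMul k A)) where
  act := LinearMap.mk₂ k (fun a f => ⟨f.1 ∘ₗ LinearMap.mulLeft k a, by
      obtain ⟨_, b, rfl⟩ := f
      refine ⟨b * a, ?_⟩
      ext c
      simp [counitMul_apply, mul_assoc]⟩)
    (fun a b x => by ext; simp [add_mul]) (fun c a x => by ext; simp)
    (fun a x y => by ext; simp) (fun c a x => by ext; simp)
  act_one x := by ext; simp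
  act_mul a b x := by ext; simp

/-- In the model, `q a` is the functional `ε(a -)` and `η` is evaluation at `1`; the last two fields
are the weak multiplicativity of `ε`. -/
theorem nonempty_unitObject (R : Realization k A G) : Nonempty (UnitObject R) := by
  obtain ⟨U, e, h⟩ := R.exists_equiv _ (counitAction k A)
  refine ⟨⟨U, e.symm.toLinearMap ∘ₗ (counitMul k A).rangeRestrict,
    LinearMap.applyₗ (1 : A) ∘ₗ Submodule.subtype _ ∘ₗ e.toLinearMap,
    e.symm.surjective.comp (LinearMap.surjective_rangeRestrict _), fun a b => ?_, fun a => ?_,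
    fun a b => ?_, fun a => ?_⟩⟩
  · apply e.injective
    simp only [LinearMap.comp_apply, LinearEquiv.coe_coe, h, LinearEquiv.apply_symm_apply]
    ext c
    simp [counitAction, counitMul_apply, mul_assoc]
  · simp [counitMul_apply]
  · apply e.injective
    ext c
    simp [counitMul_apply, mul_assoc, counit_projFst_mul]
  · apply e.injective
    ext c
    simp [counitMul_apply, counit_projSnd_mul]

end WeakBialgebra

/-! ### Compatibility of tensor products of actions with reassociation and intertwiners -/

namespace RightAction

variable {k A B D M N P : Type*} [CommRing k] [Ring A] [Algebra k A] [Ring B] [Algebra k B]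
  [Ring D] [Algebra k D] [AddCommGroup M] [Module k M] [AddCommGroup N] [Module k N]
  [AddCommGroup P] [Module k P]

theorem assoc_tensor_act (r : RightAction k A M) (s : RightAction k B N) (t : RightAction k D P)
    (z : (A ⊗[k] B) ⊗[k] D) (x : (M ⊗[k] N) ⊗[k] P) :
    TensorProduct.assoc k M N P (((r.tensor s).tensor t).act z x) =
      (r.tensor (s.tensor t)).act (TensorProduct.assoc k A B D z)
        (TensorProduct.assoc k M N P x) := by
  induction z with
  | zero => simp
  | add z w hz hw => simp only [map_add, LinearMap.add_apply, hz, hw]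
  | tmul z c =>
    induction z with
    | zero => simp
    | add z w hz hw =>
      simp only [map_add, LinearMap.add_apply, TensorProduct.add_tmul, hz, hw]
    | tmul a b =>
      induction x with
      | zero => simp
      | add x y hx hy => simp only [map_add, hx, hy]
      | tmul x p =>
        induction x with
        | zero => simp
        | add x y hx hy => simp only [map_add, TensorProduct.add_tmul, hx, hy]
        | tmul x y => simp

/-- If `f` intertwines the actions along `φ`, then so does `M ⊗ f`. -/
theorem lTensor_tensor_act (r : RightAction k A M) (s : RightAction k B N)
    (t : RightAction k D P) (φ : B →ₗ[k] D) (f : N →ₗ[k] P)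
    (h : ∀ b x, f (s.act b x) = t.act (φ b) (f x)) (z : A ⊗[k] B) (x : M ⊗[k] N) :
    f.lTensor M ((r.tensor s).act z x) = (r.tensor t).act (φ.lTensor A z) (f.lTensor M x) := by
  induction z with
  | zero => simp
  | add z w hz hw => simp only [map_add, LinearMap.add_apply, hz, hw]
  | tmul a b =>
    induction x with
    | zero => simp
    | add x y hx hy => simp only [map_add, hx, hy]
    | tmul x y => simp [h]

/-- If `f` intertwines the actions along `φ`, then so does `f ⊗ M`. -/
theorem rTensor_tensor_act (r : RightAction k A M) (s : RightAction k B N)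
    (t : RightAction k D P) (φ : B →ₗ[k] D) (f : N →ₗ[k] P)
    (h : ∀ b x, f (s.act b x) = t.act (φ b) (f x)) (z : B ⊗[k] A) (x : N ⊗[k] M) :
    f.rTensor M ((s.tensor r).act z x) = (t.tensor r).act (φ.rTensor A z) (f.rTensor M x) := by
  induction z with
  | zero => simp
  | add z w hz hw => simp only [map_add, LinearMap.add_apply, hz, hw]
  | tmul b a =>
    induction x with
    | zero => simp
    | add x y hx hy => simp only [map_add, hx, hy]
    | tmul x y => simp [h]

theorem one_tmul_act (r : RightAction k A M) (s : RightAction k B N) (b : B) (x : M ⊗[k] N) :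
    (r.tensor s).act (1 ⊗ₜ b) x = (s.act b).lTensor M x := by
  induction x with
  | zero => simp
  | add x y hx hy => simp only [map_add, hx, hy]
  | tmul x y => simp [r.act_one]

theorem tmul_one_act (r : RightAction k A M) (s : RightAction k B N) (a : A) (x : M ⊗[k] N) :
    (r.tensor s).act (a ⊗ₜ 1) x = (r.act a).rTensor N x := by
  induction x with
  | zero => simp
  | add x y hx hy => simp only [map_add, hx, hy]
  | tmul x y => simp [s.act_one]

end RightAction

theorem Realization.tensor_act_map {k A : Type u} [CommRing k] [Ring A] [Algebra k A]
    {C : Type u₁} [Category.{v₁} C] {G : C ⥤ ModuleCat.{u} k} (R : Realization k A G) {X Y X' Y' : C} (f : X ⟶ Y) (g : X' ⟶ Y') (s : A ⊗[k] A)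
    (t : G.obj X ⊗[k] G.obj X') :
    ((R.act Y).tensor (R.act Y')).act s (TensorProduct.map (G.map f).hom (G.map g).hom t) =
      TensorProduct.map (G.map f).hom (G.map g).hom (((R.act X).tensor (R.act X')).act s t) := by
  induction s with
  | zero => simp
  | add z w hz hw => simp only [map_add, LinearMap.add_apply, hz, hw]
  | tmul b a =>
    induction t with
    | zero => simp
    | add x y hx hy => simp only [map_add, hx, hy]
    | tmul x y => simp [R.map_act]

namespace WeakBialgebra

open CoalgebraStruct

section

variable (k : Type*) {A : Type*} [CommRing k] [Ring A] [Algebra k A] [WeakBialgebra k A]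

theorem assoc_rTensor_comul_comul (a : A) :
    TensorProduct.assoc k A A A (comul.rTensor A (comul a)) = comul.lTensor A (comul a) :=
  Coalgebra.coassoc_apply a

theorem mul_lTensor_comul_comul (a : A) :
    (1 : A) ⊗ₜ[k] comul (R := k) (1 : A) * comul.lTensor A (comul (R := k) a) =
      comul.lTensor A (comul a) := by
  have h (s : A ⊗[k] A) : (1 : A) ⊗ₜ[k] comul (R := k) (1 : A) * comul.lTensor A s =
      comul.lTensor A s := by
    induction s with
    | zero => simp
    | add x y hx hy => simp only [map_add, mul_add, hx, hy]
    | tmul x y => simp [comul_one_mul_comul]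
  exact h _

theorem mul_rTensor_comul_comul (a : A) :
    comul (R := k) (1 : A) ⊗ₜ[k] (1 : A) * comul.rTensor A (comul (R := k) a) =
      comul.rTensor A (comul a) := by
  have h (s : A ⊗[k] A) : comul (R := k) (1 : A) ⊗ₜ[k] (1 : A) * comul.rTensor A s =
      comul.rTensor A s := by
    induction s with
    | zero => simp
    | add x y hx hy => simp only [map_add, mul_add, hx, hy]
    | tmul x y => simp [comul_one_mul_comul]
  exact h _

end

variable {k A : Type u} [CommRing k] [Ring A] [Algebra k A] [WeakBialgebra k A] {C : Type u₁}
    [Category.{v₁} C] {G : C ⥤ ModuleCat.{u} k} {R : Realization k A G}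

/-! ### Associativity and the Frobenius conditions for the images of `Δ(1)` -/

namespace TensorObjects

variable (T : TensorObjects R)

theorem δ_injective (X Y : C) : Function.Injective (T.δ X Y) :=
  Function.LeftInverse.injective (T.μ_δ X Y)

theorem μ_act (X Y : C) (a : A) (t : G.obj X ⊗[k] G.obj Y) :
    (R.act (T.obj X Y)).act a (T.μ X Y t) =
      T.μ X Y (((R.act X).tensor (R.act Y)).act (comul a) t) := by
  apply T.δ_injective
  rw [T.δ_act, T.δ_μ, T.δ_μ, act_comul_act_comul_one, act_comul_one_act_comul]

theorem act_comul_one_δ (X Y : C) (w : G.obj (T.obj X Y)) :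
    ((R.act X).tensor (R.act Y)).act (comul 1) (T.δ X Y w) = T.δ X Y w := by
  rw [← T.δ_μ, T.μ_δ]

theorem exists_hom {X Y X' Y' : C} (f : X ⟶ Y) (g : X' ⟶ Y') :
    ∃ h : T.obj X X' ⟶ T.obj Y Y', (G.map h).hom =
      T.μ Y Y' ∘ₗ TensorProduct.map (G.map f).hom (G.map g).hom ∘ₗ T.δ X X' :=
  R.exists_map_eq _ fun a w => by
    simp only [LinearMap.comp_apply, T.δ_act, T.μ_act, R.tensor_act_map]

/-- The inclusion of a triple tensor product, bracketed on the right. -/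
noncomputable def δRight (X Y Z : C) :
    G.obj (T.obj X (T.obj Y Z)) →ₗ[k] G.obj X ⊗[k] (G.obj Y ⊗[k] G.obj Z) :=
  (T.δ Y Z).lTensor _ ∘ₗ T.δ X (T.obj Y Z)

/-- The projection to a triple tensor product, bracketed on the right. -/
noncomputable def μRight (X Y Z : C) :
    G.obj X ⊗[k] (G.obj Y ⊗[k] G.obj Z) →ₗ[k] G.obj (T.obj X (T.obj Y Z)) :=
  T.μ X (T.obj Y Z) ∘ₗ (T.μ Y Z).lTensor _

/-- The inclusion of a triple tensor product, bracketed on the left. -/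
noncomputable def δLeft (X Y Z : C) :
    G.obj (T.obj (T.obj X Y) Z) →ₗ[k] G.obj X ⊗[k] (G.obj Y ⊗[k] G.obj Z) :=
  (TensorProduct.assoc k _ _ _).toLinearMap ∘ₗ (T.δ X Y).rTensor _ ∘ₗ T.δ (T.obj X Y) Z

/-- The projection to a triple tensor product, bracketed on the left. -/
noncomputable def μLeft (X Y Z : C) :
    G.obj X ⊗[k] (G.obj Y ⊗[k] G.obj Z) →ₗ[k] G.obj (T.obj (T.obj X Y) Z) :=
  T.μ (T.obj X Y) Z ∘ₗ (T.μ X Y).rTensor _ ∘ₗ (TensorProduct.assoc k _ _ _).symm.toLinearMap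

variable (R) in
/-- The action on a triple tensor product. -/
noncomputable abbrev act₃ (X Y Z : C) :
    RightAction k (A ⊗[k] (A ⊗[k] A)) (G.obj X ⊗[k] (G.obj Y ⊗[k] G.obj Z)) :=
  (R.act X).tensor ((R.act Y).tensor (R.act Z))

theorem lTensor_μ_lTensor_δ (N : Type*) [AddCommGroup N] [Module k N] (X Y : C)
    (t : N ⊗[k] G.obj (T.obj X Y)) : (T.μ X Y).lTensor N ((T.δ X Y).lTensor N t) = t := by
  rw [← LinearMap.comp_apply, ← LinearMap.lTensor_comp,
    show T.μ X Y ∘ₗ T.δ X Y = LinearMap.id from LinearMap.ext (T.μ_δ X Y), LinearMap.lTensor_id,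
    LinearMap.id_apply]

theorem rTensor_μ_rTensor_δ (N : Type*) [AddCommGroup N] [Module k N] (X Y : C)
    (t : G.obj (T.obj X Y) ⊗[k] N) : (T.μ X Y).rTensor N ((T.δ X Y).rTensor N t) = t := by
  rw [← LinearMap.comp_apply, ← LinearMap.rTensor_comp,
    show T.μ X Y ∘ₗ T.δ X Y = LinearMap.id from LinearMap.ext (T.μ_δ X Y), LinearMap.rTensor_id,
    LinearMap.id_apply]

theorem lTensor_δ_lTensor_μ (X Y Z : C) (t : G.obj X ⊗[k] (G.obj Y ⊗[k] G.obj Z)) :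
    (T.δ Y Z).lTensor _ ((T.μ Y Z).lTensor _ t) = (act₃ R X Y Z).act (1 ⊗ₜ comul 1) t := by
  rw [RightAction.one_tmul_act, ← LinearMap.comp_apply, ← LinearMap.lTensor_comp]
  congr 2
  exact LinearMap.ext (T.δ_μ Y Z)

theorem rTensor_δ_rTensor_μ (X Y Z : C) (t : (G.obj X ⊗[k] G.obj Y) ⊗[k] G.obj Z) :
    (T.δ X Y).rTensor _ ((T.μ X Y).rTensor _ t) =
      (((R.act X).tensor (R.act Y)).tensor (R.act Z)).act (comul 1 ⊗ₜ 1) t := by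
  rw [RightAction.tmul_one_act, ← LinearMap.comp_apply, ← LinearMap.rTensor_comp]
  congr 2
  exact LinearMap.ext (T.δ_μ X Y)

theorem lTensor_δ_act (X Y Z : C) (s : A ⊗[k] A) (t : G.obj X ⊗[k] G.obj (T.obj Y Z)) :
    (T.δ Y Z).lTensor _ (((R.act X).tensor (R.act (T.obj Y Z))).act s t) =
      (act₃ R X Y Z).act (comul.lTensor A s) ((T.δ Y Z).lTensor _ t) :=
  RightAction.lTensor_tensor_act _ _ _ _ _ (T.δ_act Y Z) _ _

theorem rTensor_δ_act (X Y Z : C) (s : A ⊗[k] A) (t : G.obj (T.obj X Y) ⊗[k] G.obj Z) :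
    (T.δ X Y).rTensor _ (((R.act (T.obj X Y)).tensor (R.act Z)).act s t) =
      (((R.act X).tensor (R.act Y)).tensor (R.act Z)).act (comul.rTensor A s)
        ((T.δ X Y).rTensor _ t) :=
  RightAction.rTensor_tensor_act _ _ _ _ _ (T.δ_act X Y) _ _

theorem μRight_δRight (X Y Z : C) (w) : T.μRight X Y Z (T.δRight X Y Z w) = w := by
  simp only [μRight, δRight, LinearMap.comp_apply, lTensor_μ_lTensor_δ, T.μ_δ]

theorem μLeft_δLeft (X Y Z : C) (w) : T.μLeft X Y Z (T.δLeft X Y Z w) = w := by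
  simp only [μLeft, δLeft, LinearMap.comp_apply, LinearEquiv.coe_coe,
    LinearEquiv.symm_apply_apply, rTensor_μ_rTensor_δ, T.μ_δ]

theorem δRight_act (X Y Z : C) (a : A) (w) : T.δRight X Y Z ((R.act _).act a w) =
    (act₃ R X Y Z).act (comul.lTensor A (comul a)) (T.δRight X Y Z w) := by
  simp only [δRight, LinearMap.comp_apply, T.δ_act, lTensor_δ_act]

theorem δLeft_act (X Y Z : C) (a : A) (w) : T.δLeft X Y Z ((R.act _).act a w) =
    (act₃ R X Y Z).act (comul.lTensor A (comul a)) (T.δLeft X Y Z w) := by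
  simp only [δLeft, LinearMap.comp_apply, T.δ_act, rTensor_δ_act, LinearEquiv.coe_coe,
    RightAction.assoc_tensor_act, assoc_rTensor_comul_comul]

/-- The inner projection contributes `1 ⊗ Δ(1)`, which is absorbed by `(id ⊗ Δ)Δ(1)`. By
coassociativity the left bracketing yields the same operator, so both triple products split one
idempotent. -/
theorem δRight_μRight (X Y Z : C) (t) : T.δRight X Y Z (T.μRight X Y Z t) =
    (act₃ R X Y Z).act (comul.lTensor A (comul 1)) t := by
  simp only [δRight, μRight, LinearMap.comp_apply, T.δ_μ, lTensor_δ_act, lTensor_δ_lTensor_μ]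
  rw [← RightAction.act_mul, mul_lTensor_comul_comul]

theorem δLeft_μLeft (X Y Z : C) (t) : T.δLeft X Y Z (T.μLeft X Y Z t) =
    (act₃ R X Y Z).act (comul.lTensor A (comul 1)) t := by
  simp only [δLeft, μLeft, LinearMap.comp_apply, T.δ_μ, rTensor_δ_act, rTensor_δ_rTensor_μ,
    LinearEquiv.coe_coe]
  rw [← RightAction.act_mul, mul_rTensor_comul_comul, RightAction.assoc_tensor_act,
    assoc_rTensor_comul_comul, LinearEquiv.apply_symm_apply]

theorem act₃_δRight (X Y Z : C) (w) : (act₃ R X Y Z).act (comul.lTensor A (comul 1))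
    (T.δRight X Y Z w) = T.δRight X Y Z w := by
  rw [← δRight_μRight, μRight_δRight]

theorem act₃_δLeft (X Y Z : C) (w) : (act₃ R X Y Z).act (comul.lTensor A (comul 1))
    (T.δLeft X Y Z w) = T.δLeft X Y Z w := by
  rw [← δLeft_μLeft, μLeft_δLeft]

/-- Two splittings of the same idempotent are canonically isomorphic: include by one and project by
the other. -/
theorem exists_assoc [G.Faithful] (X Y Z : C) :
    ∃ e : T.obj (T.obj X Y) Z ≅ T.obj X (T.obj Y Z),
      (G.map e.hom).hom = T.μRight X Y Z ∘ₗ T.δLeft X Y Z ∧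
      (G.map e.inv).hom = T.μLeft X Y Z ∘ₗ T.δRight X Y Z := by
  refine R.exists_iso (LinearEquiv.ofLinearMap (T.μRight X Y Z ∘ₗ T.δLeft X Y Z)
    (T.μLeft X Y Z ∘ₗ T.δRight X Y Z) ?_ ?_) fun a w => ?_
  · ext w
    simp only [LinearMap.comp_apply, δLeft_μLeft, act₃_δRight, μRight_δRight, LinearMap.id_apply]
  · ext w
    simp only [LinearMap.comp_apply, δRight_μRight, act₃_δLeft, μLeft_δLeft, LinearMap.id_apply]
  · apply Function.LeftInverse.injective (T.μRight_δRight X Y Z)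
    simp only [LinearEquiv.coe_ofLinearMap, LinearMap.comp_apply, δRight_μRight, δRight_act,
      act₃_δLeft]
    exact T.δLeft_act X Y Z a w

/-- Under the injection `δRight` the claim is that `1 ⊗ Δ(1)` and `Δ²(1) = (Δ(1) ⊗ 1)(1 ⊗ Δ(1))`
agree on the image of `δ ⊗ id`. For a right action `Δ(1) ⊗ 1` acts first, and it fixes that image.
-/
theorem frobenius_right (X Y Z : C) (t : G.obj (T.obj X Y) ⊗[k] G.obj Z) :
    (T.μ Y Z).lTensor _ (TensorProduct.assoc k _ _ _ ((T.δ X Y).rTensor _ t)) =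
      T.δ _ _ (T.μRight X Y Z (T.δLeft X Y Z (T.μ _ _ t))) := by
  apply Function.LeftInverse.injective (T.lTensor_μ_lTensor_δ _ Y Z)
  change _ = T.δRight X Y Z _
  rw [δRight_μRight, act₃_δLeft, lTensor_δ_lTensor_μ, δLeft]
  simp only [LinearMap.comp_apply, T.δ_μ, rTensor_δ_act, LinearEquiv.coe_coe]
  rw [comul_comul_one, RightAction.act_mul, RightAction.assoc_tensor_act,
    LinearEquiv.apply_symm_apply, RightAction.tmul_one_act _ _ (comul 1), 
    ← LinearMap.comp_apply (LinearMap.rTensor _ _), ← LinearMap.rTensor_comp]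
  congr 4
  exact (LinearMap.ext (T.act_comul_one_δ X Y)).symm

/-- Mirror argument, with the opposite factorization of `Δ²(1)`: now `1 ⊗ Δ(1)` acts first and fixes
the image of `id ⊗ δ`. -/
theorem frobenius_left (X Y Z : C) (t : G.obj X ⊗[k] G.obj (T.obj Y Z)) :
    (T.μ X Y).rTensor _ ((TensorProduct.assoc k _ _ _).symm ((T.δ Y Z).lTensor _ t)) =
      T.δ _ _ (T.μLeft X Y Z (T.δRight X Y Z (T.μ _ _ t))) := by
  apply Function.LeftInverse.injective (T.rTensor_μ_rTensor_δ _ X Y)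
  apply (TensorProduct.assoc k (G.obj X) (G.obj Y) (G.obj Z)).injective
  change TensorProduct.assoc k _ _ _ ((T.δ X Y).rTensor _ _) = T.δLeft X Y Z _
  have h : TensorProduct.assoc k A A A (comul.rTensor A (comul (R := k) (1 : A))) =
      (1 : A) ⊗ₜ[k] comul (R := k) (1 : A) * TensorProduct.assoc k A A A (comul 1 ⊗ₜ[k] 1) := by
    rw [comul_comul_one']
    exact (map_mul (Algebra.TensorProduct.assoc k k k A A A) _ _).trans
      (congrArg (· * _) (LinearEquiv.apply_symm_apply (TensorProduct.assoc k A A A) _))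
  rw [δLeft_μLeft, act₃_δRight, rTensor_δ_rTensor_μ, δRight]
  simp only [LinearMap.comp_apply, T.δ_μ, lTensor_δ_act]
  rw [← assoc_rTensor_comul_comul, h, RightAction.act_mul, RightAction.assoc_tensor_act,
    LinearEquiv.apply_symm_apply, RightAction.one_tmul_act _ _ (comul 1), 
    ← LinearMap.comp_apply (LinearMap.lTensor _ _), ← LinearMap.lTensor_comp]
  congr 3
  exact (LinearMap.ext (T.act_comul_one_δ Y Z)).symm

theorem μRight_assoc (X Y Z : C) (t : (G.obj X ⊗[k] G.obj Y) ⊗[k] G.obj Z) :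
    T.μRight X Y Z (T.δLeft X Y Z (T.μ _ _ ((T.μ X Y).rTensor _ t))) =
      T.μRight X Y Z (TensorProduct.assoc k _ _ _ t) := by
  have : T.μ _ _ ((T.μ X Y).rTensor _ t) = T.μLeft X Y Z (TensorProduct.assoc k _ _ _ t) := by
    simp [μLeft]
  rw [this, δLeft_μLeft, ← δRight_μRight, μRight_δRight]

end TensorObjects

/-! ### Unit constraints -/

namespace UnitObject

variable (T : TensorObjects R) (U : UnitObject R)

theorem map_q_act_apply {X : C} (x : G.obj X) (b c : A) (s : A ⊗[k] A) :
    ((R.act U.obj).tensor (R.act X)).act s (U.q b ⊗ₜ (R.act X).act c x) =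
      TensorProduct.map U.q ((R.act X).act.flip x) (b ⊗ₜ c * s) := by
  induction s with
  | zero => simp
  | add z w hz hw => simp only [map_add, mul_add, LinearMap.add_apply, hz, hw]
  | tmul a b => simp [U.q_mul, (R.act X).act_mul]

theorem map_act_q_apply {X : C} (x : G.obj X) (b c : A) (s : A ⊗[k] A) :
    ((R.act X).tensor (R.act U.obj)).act s ((R.act X).act c x ⊗ₜ U.q b) =
      TensorProduct.map ((R.act X).act.flip x) U.q (c ⊗ₜ b * s) := by
  induction s with
  | zero => simp
  | add z w hz hw => simp only [map_add, mul_add, LinearMap.add_apply, hz, hw]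
  | tmul a b => simp [U.q_mul, (R.act X).act_mul]

theorem q_projSnd_mul (a b : A) : U.q (projSnd k A a * b) = U.q (a * b) := by
  rw [U.q_mul, U.q_projSnd, ← U.q_mul]

theorem q_projFst (a : A) : U.q (projFst k A a) = U.q a := by
  simpa using U.q_projFst_mul a 1

theorem q_comp_projFst : U.q ∘ₗ projFst k A = U.q := LinearMap.ext U.q_projFst

theorem q_comp_projSnd : U.q ∘ₗ projSnd k A = U.q := LinearMap.ext U.q_projSnd

/-- The left unit constraint. -/
noncomputable def leftHom (X : C) : G.obj (T.obj U.obj X) →ₗ[k] G.obj X :=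
  (TensorProduct.lid k _).toLinearMap ∘ₗ U.η.rTensor _ ∘ₗ T.δ U.obj X

/-- The inverse of the left unit constraint. -/
noncomputable def leftInv (X : C) : G.obj X →ₗ[k] G.obj (T.obj U.obj X) :=
  T.μ U.obj X ∘ₗ TensorProduct.mk k _ _ (U.q 1)

/-- The right unit constraint. -/
noncomputable def rightHom (X : C) : G.obj (T.obj X U.obj) →ₗ[k] G.obj X :=
  (TensorProduct.rid k _).toLinearMap ∘ₗ U.η.lTensor _ ∘ₗ T.δ X U.obj

/-- The inverse of the right unit constraint. -/
noncomputable def rightInv (X : C) : G.obj X →ₗ[k] G.obj (T.obj X U.obj) :=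
  T.μ X U.obj ∘ₗ (TensorProduct.mk k _ _).flip (U.q 1)

theorem leftHom_μ (X : C) (b c : A) (x : G.obj X) :
    U.leftHom T X (T.μ _ _ (U.q b ⊗ₜ (R.act X).act c x)) =
      (R.act X).act (counitFst k A (b ⊗ₜ c * comul 1)) x := by
  have h (s : A ⊗[k] A) : TensorProduct.lid k _ (U.η.rTensor _
      (TensorProduct.map U.q ((R.act X).act.flip x) s)) = (R.act X).act (counitFst k A s) x := by
    induction s with
    | zero => simp
    | add z w hz hw => simp only [map_add, LinearMap.add_apply, hz, hw]
    | tmul a b => simp [U.η_q]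
  simp only [leftHom, LinearMap.comp_apply, LinearEquiv.coe_coe, T.δ_μ, map_q_act_apply, h]

theorem rightHom_μ (X : C) (b c : A) (x : G.obj X) :
    U.rightHom T X (T.μ _ _ ((R.act X).act c x ⊗ₜ U.q b)) =
      (R.act X).act (counitSnd k A (c ⊗ₜ b * comul 1)) x := by
  have h (s : A ⊗[k] A) : TensorProduct.rid k _ (U.η.lTensor _
      (TensorProduct.map ((R.act X).act.flip x) U.q s)) = (R.act X).act (counitSnd k A s) x := by
    induction s with
    | zero => simp
    | add z w hz hw => simp only [map_add, LinearMap.add_apply, hz, hw]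
    | tmul a b => simp [U.η_q]
  simp only [rightHom, LinearMap.comp_apply, LinearEquiv.coe_coe, T.δ_μ, map_act_q_apply, h]

/-- Under `δ` the two sides are the images of `(1 ⊗ a)Δ(1)` and `Δ(a)` by `q ⊗ (x -)`. The former is
`(projSnd ⊗ id)Δ(a)`, and `q` does not see `projSnd`. -/
theorem leftInv_act (X : C) (a : A) (x : G.obj X) :
    U.leftInv T X ((R.act X).act a x) = (R.act _).act a (U.leftInv T X x) := by
  apply T.δ_injective
  simp only [leftInv, LinearMap.comp_apply, TensorProduct.mk_apply, T.δ_act, T.δ_μ,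
    map_q_act_apply, act_comul_act_comul_one]
  conv_rhs => rw [← (R.act X).act_one x, map_q_act_apply]
  rw [← rTensor_projSnd_comul, ← Algebra.TensorProduct.one_def, one_mul, LinearMap.rTensor,
    ← LinearMap.comp_apply, ← TensorProduct.map_comp, q_comp_projSnd, LinearMap.comp_id]

theorem rightInv_act (X : C) (a : A) (x : G.obj X) :
    U.rightInv T X ((R.act X).act a x) = (R.act _).act a (U.rightInv T X x) := by
  apply T.δ_injective
  simp only [rightInv, LinearMap.comp_apply, LinearMap.flip_apply, TensorProduct.mk_apply,
    T.δ_act, T.δ_μ, map_act_q_apply, act_comul_act_comul_one]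
  conv_rhs => rw [← (R.act X).act_one x, map_act_q_apply]
  rw [← lTensor_projFst_comul, ← Algebra.TensorProduct.one_def, one_mul, LinearMap.lTensor,
    ← LinearMap.comp_apply, ← TensorProduct.map_comp, q_comp_projFst, LinearMap.comp_id]

theorem leftHom_leftInv (X : C) (x : G.obj X) : U.leftHom T X (U.leftInv T X x) = x := by
  conv_lhs => rw [← (R.act X).act_one x]
  rw [leftInv, LinearMap.comp_apply, TensorProduct.mk_apply, leftHom_μ,
    ← Algebra.TensorProduct.one_def, one_mul, counitFst_comul, (R.act X).act_one]

theorem rightHom_rightInv (X : C) (x : G.obj X) : U.rightHom T X (U.rightInv T X x) = x := by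
  conv_lhs => rw [← (R.act X).act_one x]
  rw [rightInv, LinearMap.comp_apply, LinearMap.flip_apply, TensorProduct.mk_apply, rightHom_μ,
    ← Algebra.TensorProduct.one_def, one_mul, counitSnd_comul, (R.act X).act_one]

theorem leftInv_leftHom (X : C) (w) : U.leftInv T X (U.leftHom T X w) = w := by
  rw [← T.μ_δ _ _ w]
  generalize T.δ _ _ w = t
  induction t with
  | zero => simp
  | add x y hx hy => simp only [map_add, hx, hy]
  | tmul f x =>
    obtain ⟨a, rfl⟩ := U.surjective f
    apply T.δ_injective
    have h (s : A ⊗[k] A) : TensorProduct.map U.q ((R.act X).act.flip x)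
        (projFst k A a ⊗ₜ 1 * s) = TensorProduct.map U.q ((R.act X).act.flip x) (a ⊗ₜ 1 * s) := by
      induction s with
      | zero => simp
      | add z w hz hw => simp only [map_add, mul_add, hz, hw]
      | tmul b c => simp [U.q_projFst_mul]
    have h' := U.map_q_act_apply x a 1 (comul 1)
    have h'' := U.leftHom_μ T X a 1 x
    rw [(R.act X).act_one] at h' h''
    -- The constraint sends `q a ⊗ x` to `x` acted upon by `projFst a`. Its inverse is linear, so
    -- `Δ(projFst a) = (projFst a ⊗ 1)Δ(1)` acts on `q 1 ⊗ x`, and `q` does not distinguish `projFst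
    -- a` from `a`.
    rw [h'', ← projFst_apply, leftInv_act, T.δ_act, leftInv, LinearMap.comp_apply,
      TensorProduct.mk_apply, T.δ_μ, T.δ_μ, act_comul_act_comul_one, h', ← h, ← comul_projFst]
    conv_lhs => rw [← (R.act X).act_one x]
    rw [map_q_act_apply, ← Algebra.TensorProduct.one_def, one_mul]

theorem rightInv_rightHom (X : C) (w) : U.rightInv T X (U.rightHom T X w) = w := by
  rw [← T.μ_δ _ _ w]
  generalize T.δ _ _ w = t
  induction t with
  | zero => simp
  | add x y hx hy => simp only [map_add, hx, hy]
  | tmul x f =>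
    obtain ⟨a, rfl⟩ := U.surjective f
    apply T.δ_injective
    have h (s : A ⊗[k] A) : TensorProduct.map ((R.act X).act.flip x) U.q
        (1 ⊗ₜ projSnd k A a * s) = TensorProduct.map ((R.act X).act.flip x) U.q (1 ⊗ₜ a * s) := by
      induction s with
      | zero => simp
      | add z w hz hw => simp only [map_add, mul_add, hz, hw]
      | tmul b c => simp [U.q_projSnd_mul]
    have h' := U.map_act_q_apply x a 1 (comul 1)
    have h'' := U.rightHom_μ T X a 1 x
    rw [(R.act X).act_one] at h' h''
    rw [h'', ← projSnd_apply, rightInv_act, T.δ_act, rightInv, LinearMap.comp_apply,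
      LinearMap.flip_apply, TensorProduct.mk_apply, T.δ_μ, T.δ_μ, act_comul_act_comul_one, h',
      ← h, ← comul_projSnd]
    conv_lhs => rw [← (R.act X).act_one x]
    rw [map_act_q_apply, ← Algebra.TensorProduct.one_def, one_mul]

theorem exists_leftUnitor [G.Faithful] (X : C) : ∃ e : T.obj U.obj X ≅ X,
    (G.map e.hom).hom = U.leftHom T X := by
  -- Linearity is known for the inverse constraint, so the isomorphism is built in that direction
  -- and reversed.
  obtain ⟨e, h, h'⟩ := R.exists_iso (LinearEquiv.ofLinearMap (U.leftInv T X) (U.leftHom T X)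
    (LinearMap.ext (U.leftInv_leftHom T X)) (LinearMap.ext (U.leftHom_leftInv T X)))
    (U.leftInv_act T X)
  exact ⟨e.symm, h'⟩

theorem exists_rightUnitor [G.Faithful] (X : C) : ∃ e : T.obj X U.obj ≅ X,
    (G.map e.hom).hom = U.rightHom T X := by
  obtain ⟨e, h, h'⟩ := R.exists_iso (LinearEquiv.ofLinearMap (U.rightInv T X) (U.rightHom T X)
    (LinearMap.ext (U.rightInv_rightHom T X)) (LinearMap.ext (U.rightHom_rightInv T X)))
    (U.rightInv_act T X)
  exact ⟨e.symm, h'⟩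

end UnitObject

theorem nonempty_splitTensor [G.Faithful] (R : Realization k A G) :
    Nonempty (SplitTensor G) := by
  obtain ⟨T⟩ := nonempty_tensorObjects R
  obtain ⟨U⟩ := nonempty_unitObject R
  choose hom hhom using @T.exists_hom
  choose assoc hassoc hassoc' using T.exists_assoc
  choose leftUnitor hleft using U.exists_leftUnitor T
  choose rightUnitor hright using U.exists_rightUnitor T
  exact ⟨{
    obj := T.obj
    hom := hom
    δ := fun X Y => ModuleCat.ofHom (T.δ X Y)
    μ := fun X Y => ModuleCat.ofHom (T.μ X Y)
    δ_μ := fun X Y => by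
      ext w
      exact T.μ_δ X Y w
    map_hom_δ := fun {X Y X' Y'} f g => by
      ext w
      change T.δ _ _ ((G.map (hom f g)).hom w) =
        TensorProduct.map (G.map f).hom (G.map g).hom (T.δ _ _ w)
      rw [hhom, LinearMap.comp_apply, LinearMap.comp_apply, T.δ_μ, R.tensor_act_map,
        T.act_comul_one_δ]
    μ_map_hom := fun {X Y X' Y'} f g => by
      ext t
      change T.μ _ _ (TensorProduct.map (G.map f).hom (G.map g).hom t) =
        (G.map (hom f g)).hom (T.μ _ _ t)
      rw [hhom, LinearMap.comp_apply, LinearMap.comp_apply, T.δ_μ, ← R.tensor_act_map,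
        ← T.δ_μ, T.μ_δ]
    assoc := assoc
    map_assoc_δ := fun X Y Z => by
      ext w
      change T.δRight X Y Z ((G.map (assoc X Y Z).hom).hom w) = T.δLeft X Y Z w
      rw [hassoc, LinearMap.comp_apply, T.δRight_μRight, T.act₃_δLeft]
    μ_map_assoc := fun X Y Z => by
      ext t
      change (G.map (assoc X Y Z).hom).hom (T.μ _ _ ((T.μ X Y).rTensor _ t)) =
        T.μRight X Y Z (TensorProduct.assoc k _ _ _ t)
      rw [hassoc, LinearMap.comp_apply, T.μRight_assoc]
    frobenius_left := fun X Y Z => by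
      ext t
      change (T.μ X Y).rTensor _ ((TensorProduct.assoc k _ _ _).symm ((T.δ Y Z).lTensor _ t)) =
        T.δ _ _ ((G.map (assoc X Y Z).inv).hom (T.μ _ _ t))
      rw [hassoc', LinearMap.comp_apply, T.frobenius_left]
    frobenius_right := fun X Y Z => by
      ext t
      change (T.μ Y Z).lTensor _ (TensorProduct.assoc k _ _ _ ((T.δ X Y).rTensor _ t)) =
        T.δ _ _ ((G.map (assoc X Y Z).hom).hom (T.μ _ _ t))
      rw [hassoc, LinearMap.comp_apply, T.frobenius_right]
    unit := U.obj
    η := ModuleCat.ofHom U.η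
    -- The unit element is `q 1`, which in the dual of `A` is the functional `ε` itself.
    ε := ModuleCat.ofHom (LinearMap.toSpanSingleton k _ (U.q 1))
    leftUnitor := leftUnitor
    map_leftUnitor := fun X => ModuleCat.hom_ext (hleft X)
    ε_leftUnitor := fun X => by
      refine ModuleCat.MonoidalCategory.tensor_ext fun r x => ?_
      change (G.map (leftUnitor X).hom).hom (T.μ _ _ ((r • U.q 1) ⊗ₜ x)) = r • x
      rw [hleft, ← TensorProduct.smul_tmul', map_smul, map_smul]
      exact congrArg (r • ·) (U.leftHom_leftInv T X x)
    rightUnitor := rightUnitor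
    map_rightUnitor := fun X => ModuleCat.hom_ext (hright X)
    ε_rightUnitor := fun X => by
      refine ModuleCat.MonoidalCategory.tensor_ext fun x r => ?_
      change (G.map (rightUnitor X).hom).hom (T.μ _ _ (x ⊗ₜ (r • U.q 1))) = r • x
      rw [hright, TensorProduct.tmul_smul, map_smul, map_smul]
      exact congrArg (r • ·) (U.rightHom_rightInv T X x) }⟩

end WeakBialgebra

/-! ### The weak bialgebra defined by a separable Frobenius structure -/

theorem RightAction.map_mul_of_map_mul {k A B M N : Type*} [CommRing k] [Ring A] [Algebra k A]
    [Ring B] [Algebra k B] [AddCommGroup M] [Module k M] [AddCommGroup N] [Module k N]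
    (r : RightAction k A M) (s : RightAction k B N) (e : A →ₗ[k] M) (f : B →ₗ[k] N)
    (he : ∀ a b, e (a * b) = r.act b (e a)) (hf : ∀ a b, f (a * b) = s.act b (f a))
    (x y : A ⊗[k] B) : TensorProduct.map e f (x * y) =
      (r.tensor s).act y (TensorProduct.map e f x) := by
  induction x with
  | zero => simp
  | add x x' hx hx' => simp only [add_mul, map_add, hx, hx']
  | tmul a b =>
    induction y with
    | zero => simp
    | add y y' hy hy' => simp only [mul_add, map_add, LinearMap.add_apply, hy, hy']
    | tmul c d => simp [he, hf]

/-- An object that realizes the regular right module. -/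
structure RegularObject {k A : Type u} [CommRing k] [Ring A] [Algebra k A] {C : Type u₁}
    [Category.{v₁} C] {G : C ⥤ ModuleCat.{u} k} (R : Realization k A G) where
  /-- The object. -/
  obj : C
  /-- The identification of its value with the algebra. -/
  e : A ≃ₗ[k] G.obj obj
  e_mul : ∀ a b : A, e (a * b) = (R.act obj).act b (e a)

namespace RegularObject

section

variable {k A : Type u} [CommRing k] [Ring A] [Algebra k A] {C : Type u₁} [Category.{v₁} C]
  {G : C ⥤ ModuleCat.{u} k} {R : Realization k A G}

variable (R) in
theorem nonempty : Nonempty (RegularObject R) := by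
  obtain ⟨P, e, h⟩ := R.exists_equiv A
    { act := (LinearMap.mul k A).flip
      act_one := fun x => by simp
      act_mul := fun a b x => by simp [mul_assoc] }
  exact ⟨P, e.symm, fun a b => e.injective (by rw [h]; simp)⟩

variable (Q : RegularObject R)

theorem act_e_one (a : A) : (R.act Q.obj).act a (Q.e 1) = Q.e a := by
  rw [← Q.e_mul, one_mul]

/-- The regular module is free on `e 1`: every element of every value of `G` is an image of this
generator, so natural identities need only be checked there. -/
theorem exists_hom {X : C} (x : G.obj X) :
    ∃ f : Q.obj ⟶ X, ∀ a, (G.map f).hom (Q.e a) = (R.act X).act a x := by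
  obtain ⟨f, hf⟩ := R.exists_map_eq ((R.act X).act.flip x ∘ₗ Q.e.symm.toLinearMap) fun a y => by
    obtain ⟨b, rfl⟩ := Q.e.surjective y
    rw [← Q.e_mul]
    simp [(R.act X).act_mul]
  exact ⟨f, fun a => by simp [hf]⟩

/-- The identification of `A ⊗ A` with the tensor square of the value at the regular object. -/
noncomputable def e₂ : A ⊗[k] A ≃ₗ[k] G.obj Q.obj ⊗[k] G.obj Q.obj :=
  TensorProduct.congr Q.e Q.e

@[simp]
theorem e₂_tmul (a b : A) : Q.e₂ (a ⊗ₜ b) = Q.e a ⊗ₜ Q.e b := rfl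

theorem e₂_mul (s t : A ⊗[k] A) :
    Q.e₂ (s * t) = ((R.act Q.obj).tensor (R.act Q.obj)).act t (Q.e₂ s) :=
  RightAction.map_mul_of_map_mul _ _ Q.e.toLinearMap Q.e.toLinearMap Q.e_mul Q.e_mul s t

theorem map_map_e₂ {X Y : C} {x : G.obj X} {y : G.obj Y} {f : Q.obj ⟶ X} {g : Q.obj ⟶ Y}
    (hf : ∀ a, (G.map f).hom (Q.e a) = (R.act X).act a x)
    (hg : ∀ a, (G.map g).hom (Q.e a) = (R.act Y).act a y) (s : A ⊗[k] A) :
    TensorProduct.map (G.map f).hom (G.map g).hom (Q.e₂ s) =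
      ((R.act X).tensor (R.act Y)).act s (x ⊗ₜ y) := by
  induction s with
  | zero => simp
  | add s t hs ht => simp only [map_add, LinearMap.add_apply, hs, ht]
  | tmul a b => simp [hf, hg]

/-- The identification of `(A ⊗ A) ⊗ A` with the tensor cube of the value at the regular
object. -/
noncomputable def e₃ : (A ⊗[k] A) ⊗[k] A ≃ₗ[k]
    (G.obj Q.obj ⊗[k] G.obj Q.obj) ⊗[k] G.obj Q.obj :=
  TensorProduct.congr Q.e₂ Q.e

@[simp]
theorem e₃_tmul (s : A ⊗[k] A) (b : A) : Q.e₃ (s ⊗ₜ b) = Q.e₂ s ⊗ₜ Q.e b := rfl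

theorem e₃_mul (s t : (A ⊗[k] A) ⊗[k] A) : Q.e₃ (s * t) =
    (((R.act Q.obj).tensor (R.act Q.obj)).tensor (R.act Q.obj)).act t (Q.e₃ s) :=
  RightAction.map_mul_of_map_mul _ _ Q.e₂.toLinearMap Q.e.toLinearMap Q.e₂_mul Q.e_mul s t

theorem assoc_e₃_symm (a : A) (s : A ⊗[k] A) :
    TensorProduct.assoc k _ _ _ (Q.e₃ ((TensorProduct.assoc k A A A).symm (a ⊗ₜ s))) =
      Q.e a ⊗ₜ Q.e₂ s := by
  induction s with
  | zero => simp
  | add s t hs ht => simp only [TensorProduct.tmul_add, map_add, hs, ht]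
  | tmul b c => simp

theorem assoc_e₃ (s : (A ⊗[k] A) ⊗[k] A) : TensorProduct.assoc k _ _ _ (Q.e₃ s) =
    TensorProduct.map Q.e.toLinearMap Q.e₂.toLinearMap (TensorProduct.assoc k A A A s) := by
  obtain ⟨s, rfl⟩ := (TensorProduct.assoc k A A A).symm.surjective s
  rw [LinearEquiv.apply_symm_apply]
  induction s with
  | zero => simp
  | add s t hs ht => simp only [map_add, hs, ht]
  | tmul a s => exact Q.assoc_e₃_symm a s

end

/-! ### The lax and oplax structure maps on elements -/

section

open Functor.LaxMonoidal Functor.OplaxMonoidal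

variable {k A : Type u} [CommRing k] [Ring A] [Algebra k A] {C : Type u₁} [Category.{v₁} C]
  [MonoidalCategory C] (G : C ⥤ ModuleCat.{u} k)

section Lax

variable [G.LaxMonoidal]

/-- The multiplication of a lax monoidal functor, as a linear map. -/
abbrev μLin (X Y : C) : G.obj X ⊗[k] G.obj Y →ₗ[k] G.obj (X ⊗ Y) := (μ G X Y).hom

/-- The unit element of a lax monoidal functor. -/
abbrev unitElt : G.obj (𝟙_ C) := (ε G).hom (1 : k)

theorem map_hom_μLin {X X' Y Y' : C} (f : X ⟶ Y) (g : X' ⟶ Y') (t : G.obj X ⊗[k] G.obj X') :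
    (G.map (f ⊗ₘ g)).hom (μLin G X X' t) =
      μLin G Y Y' (TensorProduct.map (G.map f).hom (G.map g).hom t) :=
  (LinearMap.congr_fun (congrArg ModuleCat.Hom.hom (μ_natural G f g)) t).symm

theorem map_assoc_μLin (X Y Z : C) (t : (G.obj X ⊗[k] G.obj Y) ⊗[k] G.obj Z) :
    (G.map (α_ X Y Z).hom).hom (μLin G (X ⊗ Y) Z ((μLin G X Y).rTensor _ t)) =
      μLin G X (Y ⊗ Z) ((μLin G Y Z).lTensor _ (TensorProduct.assoc k _ _ _ t)) :=
  LinearMap.congr_fun (congrArg ModuleCat.Hom.hom (associativity G X Y Z)) t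

theorem map_leftUnitor_μLin {X : C} (x : G.obj X) :
    (G.map (λ_ X).hom).hom (μLin G (𝟙_ C) X (unitElt G ⊗ₜ x)) = x := by
  refine (LinearMap.congr_fun (congrArg ModuleCat.Hom.hom (left_unitality G X))
    ((1 : k) ⊗ₜ[k] x)).symm.trans ?_
  exact one_smul k x

theorem map_rightUnitor_μLin {X : C} (x : G.obj X) :
    (G.map (ρ_ X).hom).hom (μLin G X (𝟙_ C) (x ⊗ₜ unitElt G)) = x := by
  refine (LinearMap.congr_fun (congrArg ModuleCat.Hom.hom (right_unitality G X))
    (x ⊗ₜ[k] (1 : k))).symm.trans ?_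
  exact one_smul k x

end Lax

section Oplax

variable [G.OplaxMonoidal]

/-- The comultiplication of an oplax monoidal functor, as a linear map. -/
abbrev δLin (X Y : C) : G.obj (X ⊗ Y) →ₗ[k] G.obj X ⊗[k] G.obj Y := (δ G X Y).hom

/-- The counit of an oplax monoidal functor, as a linear form. -/
abbrev ηLin : G.obj (𝟙_ C) →ₗ[k] k := (η G).hom

theorem map_δLin {X X' Y Y' : C} (f : X ⟶ Y) (g : X' ⟶ Y') (w : G.obj (X ⊗ X')) :
    TensorProduct.map (G.map f).hom (G.map g).hom (δLin G X X' w) =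
      δLin G Y Y' ((G.map (f ⊗ₘ g)).hom w) :=
  LinearMap.congr_fun (congrArg ModuleCat.Hom.hom (δ_natural G f g)) w

theorem δLin_map_assoc (X Y Z : C) (w : G.obj ((X ⊗ Y) ⊗ Z)) :
    (δLin G Y Z).lTensor _ (δLin G X (Y ⊗ Z) ((G.map (α_ X Y Z).hom).hom w)) =
      TensorProduct.assoc k _ _ _ ((δLin G X Y).rTensor _ (δLin G (X ⊗ Y) Z w)) :=
  (LinearMap.congr_fun (congrArg ModuleCat.Hom.hom (oplax_associativity G X Y Z)) w).symm

theorem lid_ηLin_δLin {X : C} (w : G.obj (𝟙_ C ⊗ X)) :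
    TensorProduct.lid k _ ((ηLin G).rTensor _ (δLin G (𝟙_ C) X w)) =
      (G.map (λ_ X).hom).hom w := by
  have h : G.map (λ_ X).hom = δ G (𝟙_ C) X ≫ η G ▷ G.obj X ≫ (λ_ (G.obj X)).hom := by
    rw [← cancel_mono (λ_ (G.obj X)).inv]
    simp
  exact (LinearMap.congr_fun (congrArg ModuleCat.Hom.hom h) w).symm

theorem rid_ηLin_δLin {X : C} (w : G.obj (X ⊗ 𝟙_ C)) :
    TensorProduct.rid k _ ((ηLin G).lTensor _ (δLin G X (𝟙_ C) w)) =
      (G.map (ρ_ X).hom).hom w := by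
  have h : G.map (ρ_ X).hom = δ G X (𝟙_ C) ≫ G.obj X ◁ η G ≫ (ρ_ (G.obj X)).hom := by
    rw [← cancel_mono (ρ_ (G.obj X)).inv]
    simp
  exact (LinearMap.congr_fun (congrArg ModuleCat.Hom.hom h) w).symm

end Oplax

variable {G} [G.LaxMonoidal] {R : Realization k A G} (Q : RegularObject R)

/-- The square of the generator of the regular object. -/
noncomputable abbrev square : G.obj (Q.obj ⊗ Q.obj) :=
  μLin G Q.obj Q.obj (Q.e 1 ⊗ₜ Q.e 1)

theorem map_assoc_cube : (G.map (α_ Q.obj Q.obj Q.obj).hom).hom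
    (μLin G _ _ (Q.square ⊗ₜ Q.e 1)) = μLin G _ _ (Q.e 1 ⊗ₜ Q.square) :=
  map_assoc_μLin G Q.obj Q.obj Q.obj ((Q.e 1 ⊗ₜ Q.e 1) ⊗ₜ Q.e 1)

theorem map_assoc_inv_cube : (G.map (α_ Q.obj Q.obj Q.obj).inv).hom
    (μLin G _ _ (Q.e 1 ⊗ₜ Q.square)) = μLin G _ _ (Q.square ⊗ₜ Q.e 1) := by
  rw [← map_assoc_cube, ← LinearMap.comp_apply, ← ModuleCat.hom_comp, ← G.map_comp,
    Iso.hom_inv_id, G.map_id, ModuleCat.hom_id, LinearMap.id_apply]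

/-! ### Comultiplication, counit and their axioms -/

variable [G.OplaxMonoidal]

/-- The comultiplication `a ↦ G^2 ((u ⊗ u) a)`, where `u` is the generator of the regular
object. -/
noncomputable def comul : A →ₗ[k] A ⊗[k] A :=
  Q.e₂.symm.toLinearMap ∘ₗ δLin G Q.obj Q.obj ∘ₗ (R.act _).act.flip Q.square

variable (R) in
/-- The counit. -/
noncomputable def counit : A →ₗ[k] k := ηLin G ∘ₗ (R.act _).act.flip (unitElt G)

theorem e₂_comul (a : A) :
    Q.e₂ (Q.comul a) = δLin G Q.obj Q.obj ((R.act _).act a Q.square) := by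
  simp [comul]

theorem counit_apply (a : A) : counit R a = ηLin G ((R.act _).act a (unitElt G)) := rfl

/-- For `x ⊗ y` the image of `u ⊗ u` under two morphisms, naturality of `G_2` and `G^2` reduces this
to the regular object, where it is the definition of `Δ(1)`. -/
theorem δLin_μLin (X Y : C) (t : G.obj X ⊗[k] G.obj Y) :
    δLin G X Y (μLin G X Y t) = ((R.act X).tensor (R.act Y)).act (Q.comul 1) t := by
  induction t with
  | zero => simp
  | add t t' ht ht' => simp only [map_add, ht, ht']
  | tmul x y =>
    obtain ⟨f, hf⟩ := Q.exists_hom x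
    obtain ⟨g, hg⟩ := Q.exists_hom y
    rw [← Q.map_map_e₂ hf hg, e₂_comul, (R.act _).act_one, map_δLin, map_hom_μLin,
      TensorProduct.map_tmul, hf, hg, (R.act X).act_one, (R.act Y).act_one]

theorem μLin_δLin (hs : ∀ X Y : C, δ G X Y ≫ μ G X Y = 𝟙 (G.obj (X ⊗ Y))) (X Y : C)
    (w : G.obj (X ⊗ Y)) : μLin G X Y (δLin G X Y w) = w :=
  LinearMap.congr_fun (congrArg ModuleCat.Hom.hom (hs X Y)) w

/-- Same reduction to the generator; separability recovers `(u ⊗ u) a` from `G^2((u ⊗ u) a)`, that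
is, from `Δ(a)`. -/
theorem act_μLin (hs : ∀ X Y : C, δ G X Y ≫ μ G X Y = 𝟙 (G.obj (X ⊗ Y))) (X Y : C)
    (a : A) (t : G.obj X ⊗[k] G.obj Y) : (R.act (X ⊗ Y)).act a (μLin G X Y t) =
      μLin G X Y (((R.act X).tensor (R.act Y)).act (Q.comul a) t) := by
  induction t with
  | zero => simp
  | add t t' ht ht' => simp only [map_add, ht, ht']
  | tmul x y =>
    obtain ⟨f, hf⟩ := Q.exists_hom x
    obtain ⟨g, hg⟩ := Q.exists_hom y
    rw [← Q.map_map_e₂ hf hg, e₂_comul, ← map_hom_μLin, μLin_δLin hs, R.map_act, map_hom_μLin,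
      TensorProduct.map_tmul, hf, hg, (R.act X).act_one, (R.act Y).act_one]

theorem comul_mul_comul_one (hs : ∀ X Y : C, δ G X Y ≫ μ G X Y = 𝟙 (G.obj (X ⊗ Y)))
    (a : A) : Q.comul a * Q.comul 1 = Q.comul a := by
  apply Q.e₂.injective
  rw [e₂_mul, ← δLin_μLin, e₂_comul, μLin_δLin hs]

theorem δLin_act_μLin (hs : ∀ X Y : C, δ G X Y ≫ μ G X Y = 𝟙 (G.obj (X ⊗ Y))) (X Y : C)
    (a : A) (t : G.obj X ⊗[k] G.obj Y) : δLin G X Y ((R.act (X ⊗ Y)).act a (μLin G X Y t)) =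
      ((R.act X).tensor (R.act Y)).act (Q.comul a) t := by
  rw [Q.act_μLin hs, Q.δLin_μLin, ← RightAction.act_mul, Q.comul_mul_comul_one hs]

theorem comul_mul (hs : ∀ X Y : C, δ G X Y ≫ μ G X Y = 𝟙 (G.obj (X ⊗ Y))) (a b : A) :
    Q.comul (a * b) = Q.comul a * Q.comul b := by
  apply Q.e₂.injective
  rw [e₂_mul, e₂_comul, e₂_comul, (R.act _).act_mul, ← Q.δLin_act_μLin hs, μLin_δLin hs]

theorem map_e_lTensor_comul (s : A ⊗[k] A) :
    TensorProduct.map Q.e.toLinearMap Q.e₂.toLinearMap (Q.comul.lTensor A s) =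
      (δLin G Q.obj Q.obj).lTensor _
        (((R.act Q.obj).tensor (R.act _)).act s (Q.e 1 ⊗ₜ Q.square)) := by
  induction s with
  | zero => simp
  | add s t hs ht => simp only [map_add, LinearMap.add_apply, hs, ht]
  | tmul a b => simp [e₂_comul, act_e_one]

theorem e₃_rTensor_comul (s : A ⊗[k] A) : Q.e₃ (Q.comul.rTensor A s) =
    (δLin G Q.obj Q.obj).rTensor _
      (((R.act _).tensor (R.act Q.obj)).act s (Q.square ⊗ₜ Q.e 1)) := by
  induction s with
  | zero => simp
  | add s t hs ht => simp only [map_add, LinearMap.add_apply, hs, ht]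
  | tmul a b => simp [e₂_comul, act_e_one]

/-- Both sides are the threefold `G^2` of the cube of `u` acted upon by `a`. The associator is
compatible with `G^2`, commutes with the action and matches the two bracketings of the cube. -/
theorem coassoc (hs : ∀ X Y : C, δ G X Y ≫ μ G X Y = 𝟙 (G.obj (X ⊗ Y))) (a : A) :
    TensorProduct.assoc k A A A (Q.comul.rTensor A (Q.comul a)) =
      Q.comul.lTensor A (Q.comul a) := by
  apply (TensorProduct.congr Q.e Q.e₂).injective
  change TensorProduct.map Q.e.toLinearMap Q.e₂.toLinearMap _ =
    TensorProduct.map Q.e.toLinearMap Q.e₂.toLinearMap _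
  rw [← assoc_e₃, e₃_rTensor_comul, map_e_lTensor_comul, ← Q.δLin_act_μLin hs,
    ← Q.δLin_act_μLin hs, ← δLin_map_assoc, R.map_act, map_assoc_cube]

theorem counitFst_comul (hs : ∀ X Y : C, δ G X Y ≫ μ G X Y = 𝟙 (G.obj (X ⊗ Y))) (a : A) :
    TensorProduct.lid k A ((counit R).rTensor A (Q.comul a)) = a := by
  have h (s : A ⊗[k] A) : Q.e (TensorProduct.lid k A ((counit R).rTensor A s)) =
      TensorProduct.lid k _ ((ηLin G).rTensor _
        (((R.act _).tensor (R.act Q.obj)).act s (unitElt G ⊗ₜ Q.e 1))) := by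
    induction s with
    | zero => simp
    | add s t hs ht => simp only [map_add, LinearMap.add_apply, hs, ht]
    | tmul a b => simp [counit_apply, act_e_one]
  apply Q.e.injective
  rw [h, ← Q.δLin_act_μLin hs, lid_ηLin_δLin, R.map_act, map_leftUnitor_μLin, act_e_one]

theorem counitSnd_comul (hs : ∀ X Y : C, δ G X Y ≫ μ G X Y = 𝟙 (G.obj (X ⊗ Y))) (a : A) :
    TensorProduct.rid k A ((counit R).lTensor A (Q.comul a)) = a := by
  have h (s : A ⊗[k] A) : Q.e (TensorProduct.rid k A ((counit R).lTensor A s)) =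
      TensorProduct.rid k _ ((ηLin G).lTensor _
        (((R.act Q.obj).tensor (R.act _)).act s (Q.e 1 ⊗ₜ unitElt G))) := by
    induction s with
    | zero => simp
    | add s t hs ht => simp only [map_add, LinearMap.add_apply, hs, ht]
    | tmul a b => simp [counit_apply, act_e_one]
  apply Q.e.injective
  rw [h, ← Q.δLin_act_μLin hs, rid_ηLin_δLin, R.map_act, map_rightUnitor_μLin, act_e_one]

theorem counit_mul_mul (hs : ∀ X Y : C, δ G X Y ≫ μ G X Y = 𝟙 (G.obj (X ⊗ Y))) (a b c : A) :
    counit R (a * b * c) = LinearMap.mul' k k (TensorProduct.map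
      (counit R ∘ₗ LinearMap.mulLeft k a) (counit R ∘ₗ LinearMap.mulRight k c) (Q.comul b)) := by
  have h (s : A ⊗[k] A) : LinearMap.mul' k k (TensorProduct.map
      (counit R ∘ₗ LinearMap.mulLeft k a) (counit R ∘ₗ LinearMap.mulRight k c) s) =
      ηLin G ((R.act _).act c (TensorProduct.lid k _ ((ηLin G).rTensor _
        (((R.act _).tensor (R.act _)).act s ((R.act _).act a (unitElt G) ⊗ₜ unitElt G))))) := by
    induction s with
    | zero => simp
    | add s t hs ht => simp only [map_add, LinearMap.add_apply, hs, ht]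
    | tmul p q => simp [counit_apply, (R.act _).act_mul]
  -- Here `b` acts on the product of `1_E a` and `1_E` in `G(E ⊗ E)`. Contracting with `G^0`
  -- produces `λ_E`, whereas unitality of `G_0` needs `ρ_E`; the two coincide.
  rw [h, ← Q.δLin_act_μLin hs, lid_ηLin_δLin, R.map_act, unitors_equal, map_rightUnitor_μLin,
    counit_apply, (R.act _).act_mul, (R.act _).act_mul]

theorem counit_mul_mul' (hs : ∀ X Y : C, δ G X Y ≫ μ G X Y = 𝟙 (G.obj (X ⊗ Y))) (a b c : A) :
    counit R (a * b * c) = LinearMap.mul' k k (TensorProduct.map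
      (counit R ∘ₗ LinearMap.mulRight k c) (counit R ∘ₗ LinearMap.mulLeft k a) (Q.comul b)) := by
  have h (s : A ⊗[k] A) : LinearMap.mul' k k (TensorProduct.map
      (counit R ∘ₗ LinearMap.mulRight k c) (counit R ∘ₗ LinearMap.mulLeft k a) s) =
      ηLin G ((R.act _).act c (TensorProduct.rid k _ ((ηLin G).lTensor _
        (((R.act _).tensor (R.act _)).act s (unitElt G ⊗ₜ (R.act _).act a (unitElt G)))))) := by
    induction s with
    | zero => simp
    | add s t hs ht => simp only [map_add, LinearMap.add_apply, hs, ht]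
    | tmul p q => simp [counit_apply, (R.act _).act_mul, mul_comm]
  rw [h, ← Q.δLin_act_μLin hs, rid_ηLin_δLin, R.map_act, ← unitors_equal, map_leftUnitor_μLin,
    counit_apply, (R.act _).act_mul, (R.act _).act_mul]

theorem lTensor_δLin_μLin (X Y Z : C) (t : G.obj X ⊗[k] (G.obj Y ⊗[k] G.obj Z)) :
    (δLin G Y Z).lTensor _ ((μLin G Y Z).lTensor _ t) =
      ((R.act X).tensor ((R.act Y).tensor (R.act Z))).act (1 ⊗ₜ Q.comul 1) t := by
  rw [RightAction.one_tmul_act, ← LinearMap.comp_apply, ← LinearMap.lTensor_comp]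
  congr 2
  exact LinearMap.ext (Q.δLin_μLin Y Z)

theorem rTensor_δLin_μLin (X Y Z : C) (t : (G.obj X ⊗[k] G.obj Y) ⊗[k] G.obj Z) :
    (δLin G X Y).rTensor _ ((μLin G X Y).rTensor _ t) =
      (((R.act X).tensor (R.act Y)).tensor (R.act Z)).act (Q.comul 1 ⊗ₜ 1) t := by
  rw [RightAction.tmul_one_act, ← LinearMap.comp_apply, ← LinearMap.rTensor_comp]
  congr 2
  exact LinearMap.ext (Q.δLin_μLin X Y)

/-- The Frobenius condition evaluated at `(u ⊗ u) ⊗ u`: going through `G^2` first gives the product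
of `Δ(1) ⊗ 1` and `1 ⊗ Δ(1)`, going through `G_2` first gives `Δ²(1)`. -/
theorem comul_comul_one (hf : ∀ X Y Z : C,
      (δ G X Y ▷ G.obj Z) ≫ (α_ (G.obj X) (G.obj Y) (G.obj Z)).hom ≫ (G.obj X ◁ μ G Y Z) =
        μ G (X ⊗ Y) Z ≫ G.map (α_ X Y Z).hom ≫ δ G X (Y ⊗ Z)) :
    Q.comul.rTensor A (Q.comul 1) = (Q.comul 1 ⊗ₜ[k] (1 : A)) *
      (TensorProduct.assoc k A A A).symm ((1 : A) ⊗ₜ[k] Q.comul 1) := by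
  have h := LinearMap.congr_fun (congrArg ModuleCat.Hom.hom (hf Q.obj Q.obj Q.obj))
    (Q.square ⊗ₜ Q.e 1)
  replace h : (μLin G Q.obj Q.obj).lTensor _ (TensorProduct.assoc k _ _ _
      ((δLin G Q.obj Q.obj).rTensor _ (Q.square ⊗ₜ Q.e 1))) = δLin G _ _
        ((G.map (α_ _ _ _).hom).hom (μLin G _ _ (Q.square ⊗ₜ Q.e 1))) := h
  rw [LinearMap.rTensor_tmul] at h
  apply Q.e₃.injective
  apply (TensorProduct.assoc k (G.obj Q.obj) (G.obj Q.obj) (G.obj Q.obj)).injective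
  rw [e₃_rTensor_comul, e₃_mul, RightAction.assoc_tensor_act, LinearEquiv.apply_symm_apply,
    ← Q.lTensor_δLin_μLin, e₃_tmul, e₂_comul, (R.act _).act_one, h,
    δLin_map_assoc, Q.δLin_μLin]

theorem comul_comul_one' (hf : ∀ X Y Z : C,
      (G.obj X ◁ δ G Y Z) ≫ (α_ (G.obj X) (G.obj Y) (G.obj Z)).inv ≫ (μ G X Y ▷ G.obj Z) =
        μ G X (Y ⊗ Z) ≫ G.map (α_ X Y Z).inv ≫ δ G (X ⊗ Y) Z) :
    Q.comul.rTensor A (Q.comul 1) =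
      (TensorProduct.assoc k A A A).symm ((1 : A) ⊗ₜ[k] Q.comul 1) *
        (Q.comul 1 ⊗ₜ[k] (1 : A)) := by
  have h := LinearMap.congr_fun (congrArg ModuleCat.Hom.hom (hf Q.obj Q.obj Q.obj))
    (Q.e 1 ⊗ₜ Q.square)
  replace h : (μLin G Q.obj Q.obj).rTensor _ ((TensorProduct.assoc k _ _ _).symm
      ((δLin G Q.obj Q.obj).lTensor _ (Q.e 1 ⊗ₜ Q.square))) = δLin G _ _
        ((G.map (α_ _ _ _).inv).hom (μLin G _ _ (Q.e 1 ⊗ₜ Q.square))) := h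
  have h' : Q.e₃ ((TensorProduct.assoc k A A A).symm ((1 : A) ⊗ₜ[k] Q.comul 1)) =
      (TensorProduct.assoc k _ _ _).symm
        ((δLin G Q.obj Q.obj).lTensor _ (Q.e 1 ⊗ₜ Q.square)) := by
    rw [LinearEquiv.eq_symm_apply, assoc_e₃_symm, e₂_comul, (R.act _).act_one,
      LinearMap.lTensor_tmul]
  apply Q.e₃.injective
  rw [e₃_rTensor_comul, e₃_mul, h', ← Q.rTensor_δLin_μLin, h, map_assoc_inv_cube, Q.δLin_μLin]

end

end RegularObject

theorem Realization.nonempty_weakBialgebra {k A : Type u} [CommRing k] [Ring A] [Algebra k A]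
    {C : Type u₁} [Category.{v₁} C] [MonoidalCategory C] {G : C ⥤ ModuleCat.{u} k}
    (R : Realization k A G) (S : SeparableFrobeniusStructure G) :
    Nonempty (WeakBialgebra k A) := by
  let _ := S.toLaxMonoidal
  let _ := S.toOplaxMonoidal
  obtain ⟨Q⟩ := RegularObject.nonempty R
  exact ⟨{
    comul := Q.comul
    counit := RegularObject.counit R
    coassoc := LinearMap.ext (Q.coassoc S.separable)
    rTensor_counit_comp_comul := LinearMap.ext fun a =>
      (TensorProduct.lid k A).injective <| by
        simpa using Q.counitFst_comul S.separable a
    lTensor_counit_comp_comul := LinearMap.ext fun a =>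
      (TensorProduct.rid k A).injective <| by
        simpa using Q.counitSnd_comul S.separable a
    comul_mul := Q.comul_mul S.separable
    comul_comul_one := Q.comul_comul_one S.frobenius_right
    comul_comul_one' := Q.comul_comul_one' S.frobenius_left
    counit_mul_mul := Q.counit_mul_mul S.separable
    counit_mul_mul' := Q.counit_mul_mul' S.separable }⟩

/-! ### Realizations and equivalences over the category of `k`-modules -/

section

variable {k A : Type u} [CommRing k] [Ring A] [Algebra k A]

/-- The module over the opposite algebra defined by a right action. -/
@[reducible]
def RightAction.module {N : Type*} [AddCommGroup N] [Module k N] (r : RightAction k A N) :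
    Module Aᵐᵒᵖ N where
  smul a x := r.act a.unop x
  one_smul := r.act_one
  mul_smul a b x := r.act_mul b.unop a.unop x
  smul_zero a := map_zero (r.act a.unop)
  smul_add a := map_add (r.act a.unop)
  add_smul a b x := by
    change r.act (a.unop + b.unop) x = r.act a.unop x + r.act b.unop x
    rw [map_add, LinearMap.add_apply]
  zero_smul x := by
    change r.act 0 x = 0
    rw [map_zero, LinearMap.zero_apply]

/-- Ensures that restricting scalars along `k → Aᵐᵒᵖ` returns the original `k`-structure. -/
theorem RightAction.act_algebraMap {N : Type*} [AddCommGroup N] [Module k N]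
    (r : RightAction k A N) (c : k) (x : N) : r.act (algebraMap k A c) x = c • x := by
  rw [Algebra.algebraMap_eq_smul_one, map_smul, LinearMap.smul_apply, r.act_one]

/-- The right module defined by a right action. -/
def RightAction.toModuleCat {N : Type u} [AddCommGroup N] [Module k N] (r : RightAction k A N) :
    RightModuleCat A :=
  letI := r.module
  ModuleCat.of Aᵐᵒᵖ N

/-- The identification of a module with a right action and its associated right module. -/
def RightAction.toModuleCatEquiv {N : Type u} [AddCommGroup N] [Module k N]
    (r : RightAction k A N) : N ≃ₗ[k] (longForgetful k A).obj r.toModuleCat where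
  toFun x := x
  invFun x := x
  map_add' _ _ := rfl
  map_smul' c x := (r.act_algebraMap c x).symm

/-- The right action on the underlying `k`-module of a right module. -/
def longForgetfulAction (N : RightModuleCat A) : RightAction k A ((longForgetful k A).obj N) where
  act :=
    { toFun := fun a =>
        { toFun := fun x => MulOpposite.op a • (show N from x)
          map_add' := fun x y => smul_add (M := Aᵐᵒᵖ) (A := N) _ _ _
          map_smul' := fun c x => by
            change MulOpposite.op a • algebraMap k Aᵐᵒᵖ c • (show N from x) =
              algebraMap k Aᵐᵒᵖ c • MulOpposite.op a • (show N from x)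
            rw [smul_smul, smul_smul, Algebra.commutes] }
      map_add' := fun a b => LinearMap.ext fun x => by
        change MulOpposite.op (a + b) • (show N from x) = _
        rw [MulOpposite.op_add, add_smul]
        rfl
      map_smul' := fun c a => LinearMap.ext fun x => by
        change MulOpposite.op (c • a) • (show N from x) =
          algebraMap k Aᵐᵒᵖ c • MulOpposite.op a • (show N from x)
        rw [MulOpposite.op_smul, smul_smul, Algebra.smul_def] }
  act_one x := one_smul Aᵐᵒᵖ (show N from x)
  act_mul a b x := mul_smul (MulOpposite.op b) (MulOpposite.op a) (show N from x)

/-- Transport of a right action along an isomorphism. -/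
def RightAction.congr {M N : Type*} [AddCommGroup M] [Module k M] [AddCommGroup N] [Module k N]
    (r : RightAction k A N) (e : M ≃ₗ[k] N) : RightAction k A M where
  act := (LinearEquiv.arrowCongr e.symm e.symm).toLinearMap ∘ₗ r.act
  act_one x := by simp [r.act_one]
  act_mul a b x := by simp [r.act_mul]

@[simp]
theorem RightAction.congr_act {M N : Type*} [AddCommGroup M] [Module k M] [AddCommGroup N]
    [Module k N] (r : RightAction k A N) (e : M ≃ₗ[k] N) (a : A) (x : M) :
    (r.congr e).act a x = e.symm (r.act a (e x)) := by
  simp [RightAction.congr]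

variable {C : Type u₁} [Category.{v₁} C] {G : C ⥤ ModuleCat.{u} k}

namespace Realization

section

variable (R : Realization k A G)

/-- The functor to right modules defined by a realization. -/
def toModules : C ⥤ RightModuleCat A where
  obj X := (R.act X).toModuleCat
  map {X Y} f :=
    letI := (R.act X).module
    letI := (R.act Y).module
    ModuleCat.ofHom (X := G.obj X) (Y := G.obj Y)
      { toFun := (G.map f).hom
        map_add' := map_add _
        map_smul' := fun a x => R.map_act f a.unop x }
  map_id X := by
    ext x
    exact LinearMap.congr_fun (congrArg ModuleCat.Hom.hom (G.map_id X)) x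
  map_comp f g := by
    ext x
    exact LinearMap.congr_fun (congrArg ModuleCat.Hom.hom (G.map_comp f g)) x

/-- The underlying `k`-modules of the modules defined by a realization. -/
noncomputable def toModulesForget : G ≅ R.toModules ⋙ longForgetful k A :=
  NatIso.ofComponents (fun X => (R.act X).toModuleCatEquiv.toModuleIso) fun _ => rfl

theorem toModules_isEquivalence [G.Faithful] : R.toModules.IsEquivalence where
  faithful := ⟨fun {X Y} f g h => G.map_injective (by
    ext x
    exact LinearMap.congr_fun (congrArg ModuleCat.Hom.hom h) x)⟩
  full := ⟨fun {X Y} φ => by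
    obtain ⟨f, hf⟩ := R.exists_map_eq
      ((R.act Y).toModuleCatEquiv.symm.toLinearMap ∘ₗ ((longForgetful k A).map φ).hom ∘ₗ
        (R.act X).toModuleCatEquiv.toLinearMap)
      (fun a x => φ.hom.map_smul (MulOpposite.op a) x)
    refine ⟨f, ?_⟩
    ext x
    exact LinearMap.congr_fun hf x⟩
  essSurj := ⟨fun N => by
    obtain ⟨X, e, he⟩ := R.exists_equiv _ (longForgetfulAction (k := k) N)
    refine ⟨X, ⟨?_⟩⟩
    let := (R.act X).module
    exact LinearEquiv.toModuleIso (X₁ := G.obj X) (X₂ := N)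
      { toFun := e
        invFun := e.symm
        left_inv := e.left_inv
        right_inv := e.right_inv
        map_add' := map_add e
        map_smul' := fun a x => he a.unop x }⟩

theorem equivalentOver [Preadditive C] [CategoryTheory.Linear k C] [G.Faithful] [G.Additive]
    [G.Linear k] (R : Realization k A G) : EquivalentOver k G (longForgetful k A) := by
  have := R.toModules_isEquivalence
  refine ⟨R.toModules.asEquivalence, ⟨fun {X Y f g} => ?_⟩, ⟨fun {X Y} f c => ?_⟩,
    ⟨R.toModulesForget⟩⟩
  · ext x
    exact LinearMap.congr_fun (congrArg ModuleCat.Hom.hom (G.map_add (f := f) (g := g))) x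
  · ext x
    exact (LinearMap.congr_fun (congrArg ModuleCat.Hom.hom (G.map_smul c f)) x).trans
      ((R.act Y).act_algebraMap c _).symm

end

theorem nonempty_of_iso (K : C ≌ RightModuleCat A) (φ : G ≅ K.functor ⋙ longForgetful k A) :
    Nonempty (Realization k A G) := by
  let e (X : C) : G.obj X ≃ₗ[k] (longForgetful k A).obj (K.functor.obj X) :=
    (φ.app X).toLinearEquiv
  have he {X Y : C} (f : X ⟶ Y) (x : G.obj X) :
      e Y ((G.map f).hom x) = ((longForgetful k A).map (K.functor.map f)).hom (e X x) :=
    LinearMap.congr_fun (congrArg ModuleCat.Hom.hom (φ.hom.naturality f)) x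
  refine ⟨⟨fun X => (longForgetfulAction (K.functor.obj X)).congr (e X), fun {X Y} f a x => ?_,
    fun {X Y} ψ h => ?_, fun N _ _ r => ?_⟩⟩
  · apply (e Y).injective
    rw [he, RightAction.congr_act, RightAction.congr_act, LinearEquiv.apply_symm_apply,
      LinearEquiv.apply_symm_apply, he]
    exact map_smul (K.functor.map f).hom (MulOpposite.op a) _
  · let F : (longForgetful k A).obj (K.functor.obj X) →ₗ[k]
        (longForgetful k A).obj (K.functor.obj Y) :=
      (e Y).toLinearMap ∘ₗ ψ ∘ₗ (e X).symm.toLinearMap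
    have hF (a : A) (x : (longForgetful k A).obj (K.functor.obj X)) :
        F ((longForgetfulAction _).act a x) = (longForgetfulAction _).act a (F x) := by
      have := congrArg (e Y) (h a ((e X).symm x))
      simp only [RightAction.congr_act, LinearEquiv.apply_symm_apply] at this
      exact this
    let g : K.functor.obj X ⟶ K.functor.obj Y := ModuleCat.ofHom
      { toFun := F
        map_add' := map_add F
        map_smul' := fun a x => hF a.unop x }
    obtain ⟨f, hf⟩ := K.functor.map_surjective g
    refine ⟨f, LinearMap.ext fun x => (e Y).injective ?_⟩
    rw [he, hf]
    change e Y (ψ ((e X).symm (e X x))) = _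
    rw [LinearEquiv.symm_apply_apply]
  · let i := K.functor.objObjPreimageIso r.toModuleCat
    refine ⟨K.functor.objPreimage r.toModuleCat, (e _).trans
      (((longForgetful k A).mapIso i).toLinearEquiv.trans r.toModuleCatEquiv.symm), fun a x => ?_⟩
    rw [RightAction.congr_act]
    simp only [LinearEquiv.trans_apply, LinearEquiv.apply_symm_apply]
    exact map_smul i.hom.hom (MulOpposite.op a) _

end Realization

end

/-! ### The long forgetful functor is monadic -/

/-- A functor equivalent to a monadic functor is monadic. -/
theorem isMonadic_of_equivalence {C : Type u₁} [Category.{v₁} C] {D : Type u₂} [Category.{v₂} D]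
    {M : Type u₃} [Category.{v₃} M] {G : C ⥤ M} {U : D ⥤ M} (h : IsMonadic U) (K : C ≌ D)
    (φ : G ≅ K.functor ⋙ U) : IsMonadic G := by
  obtain ⟨⟨L, adj, hadj⟩⟩ := h
  let adj' : L ⋙ K.inverse ⊣ G := (adj.comp K.symm.toAdjunction).ofNatIsoRight φ.symm
  have hunit (N : M) : adj'.unit.app N = adj.unit.app N ≫
      U.map (K.counitInv.app (L.obj N)) ≫ φ.inv.app (K.inverse.obj (L.obj N)) := by
    simp [adj']
  have hcounit (X : C) : adj'.counit.app X = K.inverse.map (L.map (φ.hom.app X)) ≫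
      K.inverse.map (adj.counit.app (K.functor.obj X)) ≫ K.unitInv.app X := by
    simp [adj']
  have hφ {X Y : C} (f : X ⟶ Y) :
      G.map f ≫ φ.hom.app Y = φ.hom.app X ≫ U.map (K.functor.map f) := φ.hom.naturality f
  -- The components of an isomorphism between the two monads; the unit and multiplication laws are
  -- verified in `i`.
  let t (N : M) : G.obj (K.inverse.obj (L.obj N)) ≅ U.obj (L.obj N) :=
    φ.app _ ≪≫ U.mapIso (K.counitIso.app (L.obj N))
  have ht (N : M) : (t N).hom = φ.hom.app (K.inverse.obj (L.obj N)) ≫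
    U.map (K.counit.app (L.obj N)) := rfl
  have htn {X Y : M} (f : X ⟶ Y) : G.map (K.inverse.map (L.map f)) ≫ (t Y).hom =
      (t X).hom ≫ U.map (L.map f) := by
    rw [ht, ht, reassoc_of% hφ, Category.assoc, ← U.map_comp, ← U.map_comp]
    simp
  let c (X : C) : K.inverse.obj (L.obj (G.obj X)) ⟶ X := adj'.counit.app X
  have hc (X : C) : G.map (c X) ≫ φ.hom.app X =
      (t (G.obj X)).hom ≫ U.map (L.map (φ.hom.app X)) ≫
        U.map (adj.counit.app (K.functor.obj X)) := by
    have hcX : c X = K.inverse.map (L.map (φ.hom.app X)) ≫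
      K.inverse.map (adj.counit.app (K.functor.obj X)) ≫ K.unitInv.app X := hcounit X
    rw [hφ, ht, hcX, Category.assoc, ← U.map_comp, ← U.map_comp]
    congr 2
    simp
  let i : adj'.toMonad ≅ adj.toMonad := MonadIso.mk
    (NatIso.ofComponents t fun f => htn f)
    (fun X => by
      change adj'.unit.app X ≫ (t X).hom = adj.unit.app X
      rw [ht, hunit]
      simp [← U.map_comp])
    (fun X => by
      change G.map (c (K.inverse.obj (L.obj X))) ≫ (t X).hom =
        (G.map (K.inverse.map (L.map (t X).hom)) ≫ (t (U.obj (L.obj X))).hom) ≫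
          U.map (adj.counit.app (L.obj X))
      have h := hc (K.inverse.obj (L.obj X))
      have h' := adj.counit.naturality (K.counit.app (L.obj X))
      rw [htn, ht X, reassoc_of% h]
      simp only [Category.assoc, ← U.map_comp, L.map_comp]
      congr 3
      exact h'.symm)
  -- The comparison functors form a square with `K` and the equivalence of algebra categories
  -- induced by `i`. It commutes up to isomorphism, and three of its sides are equivalences, so the
  -- fourth is one.
  let j : Monad.comparison adj' ⋙ (Monad.algebraEquivOfIsoMonads i).functor ≅
      K.functor ⋙ Monad.comparison adj :=
    NatIso.ofComponents (fun X => Monad.Algebra.isoMk (φ.app X) (by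
      change U.map (L.map (φ.hom.app X)) ≫ U.map (adj.counit.app (K.functor.obj X)) =
        ((t (G.obj X)).inv ≫ G.map (c X)) ≫ φ.hom.app X
      rw [Category.assoc, Iso.eq_inv_comp, hc]))
      fun {X Y} f => by
        ext
        exact hφ f
  have := Functor.isEquivalence_of_iso j.symm
  exact ⟨⟨_, adj', Functor.isEquivalence_of_comp_right _
    (Monad.algebraEquivOfIsoMonads i).functor⟩⟩

section

variable (k A : Type u) [CommRing k] [Ring A] [Algebra k A]

theorem longForgetful_isLeftAdjoint : (longForgetful k A).IsLeftAdjoint :=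
  (ModuleCat.restrictCoextendScalarsAdj (algebraMap k Aᵐᵒᵖ)).isLeftAdjoint

open scoped ModuleCat.Algebra in
theorem longForgetful_isRightAdjoint : (longForgetful k A).IsRightAdjoint := by
  -- The left adjoint is `N ↦ Aᵐᵒᵖ ⊗ N`; a linear map out of it is determined by its values on `1 ⊗
  -- n`.
  let e (N : ModuleCat.{u} k) (X : RightModuleCat A) :
      (ModuleCat.of Aᵐᵒᵖ (Aᵐᵒᵖ ⊗[k] N) ⟶ X) ≃ (N ⟶ (longForgetful k A).obj X) :=
    { toFun := fun f => ModuleCat.ofHom (Y := (longForgetful k A).obj X)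
        { toFun := fun n => f.hom (1 ⊗ₜ n)
          map_add' := fun x y => by
            rw [TensorProduct.tmul_add, map_add]
            rfl
          map_smul' := fun c x => by
            rw [TensorProduct.tmul_smul, ← algebraMap_smul Aᵐᵒᵖ c, map_smul]
            rfl }
      invFun := fun g => ModuleCat.ofHom
        (TensorProduct.AlgebraTensorModule.lift
          (LinearMap.toSpanSingleton Aᵐᵒᵖ (N →ₗ[k] X) g.hom))
      left_inv := fun f => by
        ext x
        exact one_smul Aᵐᵒᵖ (f.hom (1 ⊗ₜ x))
      right_inv := fun g => by
        ext x
        exact one_smul Aᵐᵒᵖ (show X from g.hom x) }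
  exact (Adjunction.adjunctionOfEquivLeft e (fun X Y Y' g h => by rfl)).isRightAdjoint

/-- Beck's theorem for reflexive coequalizers: restriction of scalars reflects isomorphisms and
preserves colimits because it also has a right adjoint. -/
theorem longForgetful_isMonadic : IsMonadic (longForgetful k A) := by
  have := longForgetful_isRightAdjoint k A
  have : (longForgetful k A).ReflectsIsomorphisms :=
    inferInstanceAs (ModuleCat.restrictScalars _).ReflectsIsomorphisms
  have := longForgetful_isLeftAdjoint k A
  have := (Adjunction.ofIsLeftAdjoint (longForgetful k A)).leftAdjoint_preservesColimits.{0, 0}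
  have : Monad.PreservesColimitOfIsReflexivePair (longForgetful k A) :=
    ⟨fun _ _ _ _ _ => inferInstance⟩
  exact ⟨Monad.monadicOfHasPreservesReflexiveCoequalizersOfReflectsIsomorphisms
    (Adjunction.ofIsRightAdjoint (longForgetful k A))⟩

end

/-! ### The algebra defined by a monadic functor with a right adjoint -/

section

variable {k : Type u} [CommRing k] {C : Type u₁} [Category.{v₁} C]
  {G : C ⥤ ModuleCat.{u} k} {F : ModuleCat.{u} k ⥤ C} (adj : F ⊣ G)

/-- The morphism from the free module of rank one that selects an element. -/
def elementHom {N : ModuleCat.{u} k} (x : N) : ModuleCat.of k k ⟶ N :=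
  ModuleCat.ofHom (LinearMap.toSpanSingleton k N x)

theorem elementHom_apply_one {N : ModuleCat.{u} k} (x : N) : (elementHom x).hom (1 : k) = x :=
  one_smul k x

theorem elementHom_comp {N N' : ModuleCat.{u} k} (x : N) (f : N ⟶ N') :
    elementHom x ≫ f = elementHom (f.hom x) := by
  ext
  exact (congrArg f.hom (one_smul k x)).trans (one_smul k _).symm

/-- The value of `G` at the image of `k` under a left adjoint. -/
abbrev GeneratorAlgebra (_ : F ⊣ G) : ModuleCat.{u} k := G.obj (F.obj (ModuleCat.of k k))

namespace GeneratorAlgebra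

/-- The universal element. -/
def generator : GeneratorAlgebra adj := (adj.unit.app (ModuleCat.of k k)).hom (1 : k)

/-- The morphism that corresponds to an element by the universal property. -/
def lift {X : C} (x : G.obj X) : F.obj (ModuleCat.of k k) ⟶ X :=
  (adj.homEquiv _ _).symm (elementHom x)

/-- The underlying set of `G X` is represented by `F k`, with the generator as universal element. -/
theorem map_lift_generator {X : C} (x : G.obj X) :
    (G.map (lift adj x)).hom (generator adj) = x := by
  have h : adj.unit.app (ModuleCat.of k k) ≫ G.map (lift adj x) = elementHom x := by
    exact (adj.homEquiv_unit _ _ _).symm.trans (Equiv.apply_symm_apply _ _)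
  exact (LinearMap.congr_fun (congrArg ModuleCat.Hom.hom h) (1 : k)).trans
    (elementHom_apply_one x)

theorem lift_eq {X : C} (f : F.obj (ModuleCat.of k k) ⟶ X) {x : G.obj X}
    (h : (G.map f).hom (generator adj) = x) : lift adj x = f := by
  rw [lift, Equiv.symm_apply_eq, adj.homEquiv_unit, ← h]
  ext
  exact one_smul k _

theorem lift_comp {X Y : C} (x : G.obj X) (f : X ⟶ Y) :
    lift adj x ≫ f = lift adj ((G.map f).hom x) := by
  refine (lift_eq adj _ ?_).symm
  rw [G.map_comp, ModuleCat.hom_comp, LinearMap.comp_apply, map_lift_generator]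

theorem lift_generator : lift adj (generator adj) = 𝟙 _ :=
  lift_eq adj _ (by rw [G.map_id]; rfl)

theorem lift_eq_map_comp {X : C} (x : G.obj X) :
    lift adj x = F.map (elementHom x) ≫ adj.counit.app X :=
  adj.homEquiv_counit _ _ _

/-- The morphism `G F k ⟶ G F N` defined by an element of `N`. -/
abbrev insertion {N : ModuleCat.{u} k} (n : N) : GeneratorAlgebra adj ⟶ G.obj (F.obj N) :=
  G.map (F.map (elementHom n))

theorem insertion_comp {N N' : ModuleCat.{u} k} (n : N) (f : N ⟶ N') :
    insertion adj n ≫ G.map (F.map f) = insertion adj (f.hom n) := by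
  rw [← G.map_comp, ← F.map_comp, elementHom_comp]

theorem insertion_generator {N : ModuleCat.{u} k} (n : N) :
    (insertion adj n).hom (generator adj) = (adj.unit.app N).hom n := by
  have h := adj.unit.naturality (elementHom n)
  refine (LinearMap.congr_fun (congrArg ModuleCat.Hom.hom h) (1 : k)).symm.trans ?_
  exact congrArg (adj.unit.app N).hom (elementHom_apply_one n)

/-! ### Module structures over the monad by means of the right adjoint -/

variable {H : ModuleCat.{u} k ⥤ C} (adj' : G ⊣ H)

/-- Morphisms out of `G F N` as morphisms out of `N`. -/
def homEquiv (N Z : ModuleCat.{u} k) : (G.obj (F.obj N) ⟶ Z) ≃ (N ⟶ G.obj (H.obj Z)) :=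
  (adj'.homEquiv (F.obj N) Z).trans (adj.homEquiv N (H.obj Z))

theorem homEquiv_naturality {N N' Z : ModuleCat.{u} k} (f : N ⟶ N')
    (p : G.obj (F.obj N') ⟶ Z) :
    homEquiv adj adj' N Z (G.map (F.map f) ≫ p) = f ≫ homEquiv adj adj' N' Z p := by
  simp only [homEquiv, Equiv.trans_apply, Adjunction.homEquiv_naturality_left]

/-- The right adjoint turns morphisms out of `G F N` into morphisms out of `N`, which are determined
on elements `k ⟶ N`. This replaces a presentation of `N` by free modules. -/
theorem hom_ext (adj' : G ⊣ H) {N Z : ModuleCat.{u} k} {p q : G.obj (F.obj N) ⟶ Z}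
    (h : ∀ (n : N) (a : GeneratorAlgebra adj),
      p.hom ((insertion adj n).hom a) = q.hom ((insertion adj n).hom a)) : p = q := by
  apply (homEquiv adj adj' N Z).injective
  ext n
  have hn : insertion adj n ≫ p = insertion adj n ≫ q := by
    ext a
    exact h n a
  have := congrArg (homEquiv adj adj' _ Z) hn
  rw [insertion, homEquiv_naturality, homEquiv_naturality, elementHom_comp, elementHom_comp] at this
  rw [← elementHom_apply_one ((homEquiv adj adj' N Z p).hom n), this, elementHom_apply_one]

variable [Preadditive C]

section

variable [G.Additive]

theorem lift_add {X : C} (x y : G.obj X) : lift adj (x + y) = lift adj x + lift adj y :=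
  lift_eq adj _ (by
    rw [G.map_add, ModuleCat.hom_add, LinearMap.add_apply, map_lift_generator,
      map_lift_generator])

theorem homEquiv_add {N Z : ModuleCat.{u} k} (p q : G.obj (F.obj N) ⟶ Z) :
    homEquiv adj adj' N Z (p + q) = homEquiv adj adj' N Z p + homEquiv adj adj' N Z q := by
  have h : adj'.homEquiv (F.obj N) Z (p + q) = adj'.homEquiv _ _ p + adj'.homEquiv _ _ q := by
    rw [← Equiv.eq_symm_apply, Adjunction.homEquiv_counit, G.map_add, Preadditive.add_comp,
      ← Adjunction.homEquiv_counit, ← Adjunction.homEquiv_counit, Equiv.symm_apply_apply,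
      Equiv.symm_apply_apply]
  simp only [homEquiv, Equiv.trans_apply, h]
  rw [Adjunction.homEquiv_unit, G.map_add, Preadditive.comp_add, ← Adjunction.homEquiv_unit,
    ← Adjunction.homEquiv_unit]

end

variable [CategoryTheory.Linear k C] [G.Linear k]

theorem lift_smul {X : C} (c : k) (x : G.obj X) : lift adj (c • x) = c • lift adj x :=
  lift_eq adj _ (by
    rw [G.map_smul, ModuleCat.hom_smul, LinearMap.smul_apply, map_lift_generator])

theorem homEquiv_smul {N Z : ModuleCat.{u} k} (c : k) (p : G.obj (F.obj N) ⟶ Z) :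
    homEquiv adj adj' N Z (c • p) = c • homEquiv adj adj' N Z p := by
  have h : adj'.homEquiv (F.obj N) Z (c • p) = c • adj'.homEquiv _ _ p := by
    rw [← Equiv.eq_symm_apply, Adjunction.homEquiv_counit, G.map_smul, Linear.smul_comp,
      ← Adjunction.homEquiv_counit, Equiv.symm_apply_apply]
  simp only [homEquiv, Equiv.trans_apply, h]
  rw [Adjunction.homEquiv_unit, G.map_smul, Linear.comp_smul, ← Adjunction.homEquiv_unit]

variable [G.Additive]

/-- The operators `x ↦ G(x̂)(a)`, where `x̂` is the morphism that corresponds to `x`. -/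
def act (X : C) : GeneratorAlgebra adj →ₗ[k] G.obj X →ₗ[k] G.obj X :=
  LinearMap.mk₂ k (fun (a : G.obj (F.obj (ModuleCat.of k k))) x => (G.map (lift adj x)).hom a)
    (fun a b x => map_add (G.map (lift adj x)).hom a b)
    (fun c a x => map_smul (G.map (lift adj x)).hom c a)
    (fun a x y => by rw [lift_add, G.map_add, ModuleCat.hom_add, LinearMap.add_apply])
    (fun c a x => by rw [lift_smul, G.map_smul, ModuleCat.hom_smul, LinearMap.smul_apply])

theorem act_apply {X : C} (a : GeneratorAlgebra adj) (x : G.obj X) :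
    act adj X a x = (G.map (lift adj x)).hom a := rfl

theorem map_act {X Y : C} (f : X ⟶ Y) (a : GeneratorAlgebra adj) (x : G.obj X) :
    (G.map f).hom (act adj X a x) = act adj Y a ((G.map f).hom x) := by
  rw [act_apply, act_apply, ← lift_comp, G.map_comp]
  rfl

theorem act_generator {X : C} (x : G.obj X) : act adj X (generator adj) x = x :=
  map_lift_generator adj x

theorem act_act {X : C} (a b : GeneratorAlgebra adj) (x : G.obj X) :
    act adj X b (act adj X a x) = act adj X (act adj _ b a) x := by
  rw [act_apply adj a x, ← map_act]
  rfl

/-- The multiplication `a b = G(â)(b)`. -/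
@[reducible]
def ring : Ring (GeneratorAlgebra adj) where
  __ := (inferInstance : AddCommGroup (GeneratorAlgebra adj))
  mul a b := act adj _ b a
  one := generator adj
  mul_assoc a b c := act_act adj b c a
  one_mul a := by
    change (G.map (lift adj (generator adj))).hom a = a
    rw [lift_generator, G.map_id]
    rfl
  mul_one a := act_generator adj a
  left_distrib a b c := by
    change act adj _ (b + c) _ = _
    rw [map_add]
    rfl
  right_distrib a b c := map_add (act adj _ c) a b
  zero_mul a := map_zero (act adj _ a)
  mul_zero a := by
    change act adj _ 0 _ = _
    rw [map_zero]
    rfl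

/-- The `k`-algebra structure. -/
@[reducible]
def algebra : letI := ring adj; Algebra k (GeneratorAlgebra adj) :=
  letI := ring adj
  Algebra.ofModule (fun c a b => map_smul (act adj _ b) c a)
    (fun c a b => LinearMap.congr_fun (map_smul (act adj _) c b) a)

attribute [local instance] ring algebra

/-- The right action on the values of `G`. -/
def action (X : C) : RightAction k (GeneratorAlgebra adj) (G.obj X) where
  act := act adj X
  act_one := act_generator adj
  act_mul a b x := (act_act adj a b x).symm

theorem map_counit_insertion {X : C} (x : G.obj X) (a : GeneratorAlgebra adj) :
    (G.map (adj.counit.app X)).hom ((insertion adj x).hom a) = act adj X a x := by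
  rw [act_apply, lift_eq_map_comp, G.map_comp]
  rfl

/-- The action of `G F k` on a module as a morphism `G F N ⟶ N`. -/
def structureHom (N : ModuleCat.{u} k) (r : GeneratorAlgebra adj →ₗ[k] N →ₗ[k] N) :
    G.obj (F.obj N) ⟶ N :=
  (homEquiv adj adj' N N).symm <| ModuleCat.ofHom
    -- The value at `n` is forced: restricting the desired map along the insertion of `n` must give
    -- `a ↦ r a n`, and naturality of the adjunction evaluates its transpose at `1`.
    { toFun := fun n => (homEquiv adj adj' _ N (ModuleCat.ofHom (r.flip n))).hom (1 : k)
      map_add' := fun x y => by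
        rw [map_add, ModuleCat.ofHom_add, homEquiv_add]
        rfl
      map_smul' := fun c x => by
        rw [map_smul, show ModuleCat.ofHom (c • r.flip x) = c • ModuleCat.ofHom (r.flip x) from rfl,
          homEquiv_smul]
        rfl }

theorem structureHom_insertion (N : ModuleCat.{u} k)
    (r : GeneratorAlgebra adj →ₗ[k] N →ₗ[k] N) (n : N) (a : GeneratorAlgebra adj) :
    (structureHom adj adj' N r).hom ((insertion adj n).hom a) = r a n := by
  have h : insertion adj n ≫ structureHom adj adj' N r = ModuleCat.ofHom (r.flip n) := by
    apply (homEquiv adj adj' _ N).injective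
    rw [insertion, homEquiv_naturality, structureHom, Equiv.apply_symm_apply, elementHom_comp]
    ext
    exact elementHom_apply_one _
  exact LinearMap.congr_fun (congrArg ModuleCat.Hom.hom h) a

/-- Tested on insertions, where the structure map is the action itself, the claim is the
associativity of `r`. -/
theorem structureHom_act (N : ModuleCat.{u} k) (r : RightAction k (GeneratorAlgebra adj) N)
    (a : GeneratorAlgebra adj) (y : G.obj (F.obj N)) :
    (structureHom adj adj' N r.act).hom (act adj _ a y) =
      r.act a ((structureHom adj adj' N r.act).hom y) := by
  have h : ModuleCat.ofHom (act adj (F.obj N) a) ≫ structureHom adj adj' N r.act =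
      structureHom adj adj' N r.act ≫ ModuleCat.ofHom (r.act a) := by
    refine hom_ext adj adj' fun n b => ?_
    change (structureHom adj adj' N r.act).hom (act adj _ a ((insertion adj n).hom b)) =
      r.act a ((structureHom adj adj' N r.act).hom ((insertion adj n).hom b))
    rw [← map_act, structureHom_insertion, structureHom_insertion]
    exact r.act_mul b a n
  exact LinearMap.congr_fun (congrArg ModuleCat.Hom.hom h) y

/-- The algebra over the monad `G F` defined by a right action. -/
def monadAlgebra (N : ModuleCat.{u} k) (r : RightAction k (GeneratorAlgebra adj) N) :
    adj.toMonad.Algebra where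
  A := N
  a := structureHom adj adj' N r.act
  unit := by
    ext n
    refine (congrArg (structureHom adj adj' N r.act).hom (insertion_generator adj n)).symm.trans ?_
    exact (structureHom_insertion adj adj' N r.act n (generator adj)).trans (r.act_one n)
  assoc := by
    refine hom_ext adj adj' (N := G.obj (F.obj N)) fun y a => ?_
    refine (congrArg (structureHom adj adj' N r.act).hom
      (map_counit_insertion adj (X := F.obj N) y a)).trans ?_
    refine (structureHom_act adj adj' N r a y).trans ?_
    refine (structureHom_insertion adj adj' N r.act _ a).symm.trans ?_
    rw [← insertion_comp]
    rfl

/-- On insertions a monad algebra structure is an action of `A`, and compatibility with structure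
maps is `A`-linearity. Since the comparison functor is full and essentially surjective, linear maps
and right modules lift to `C`. -/
theorem nonempty_realization (adj' : G ⊣ H) [(Monad.comparison adj).IsEquivalence] :
    Nonempty (Realization k (GeneratorAlgebra adj) G) := by
  refine ⟨⟨action adj, fun f a x => map_act adj f a x, fun {X Y} φ h => ?_, fun N _ _ r => ?_⟩⟩
  · let g : (Monad.comparison adj).obj X ⟶ (Monad.comparison adj).obj Y :=
      { f := ModuleCat.ofHom φ
        h := by
          refine hom_ext adj adj' (N := G.obj X) fun x a => ?_
          refine Eq.trans ?_ ((h a x).symm.trans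
            (congrArg φ (map_counit_insertion adj x a)).symm)
          refine Eq.trans ?_ (map_counit_insertion adj (φ x) a)
          refine congrArg (G.map (adj.counit.app Y)).hom ?_
          exact LinearMap.congr_fun (congrArg ModuleCat.Hom.hom
            (insertion_comp adj x (ModuleCat.ofHom φ))) a }
    obtain ⟨f, hf⟩ := (Monad.comparison adj).map_surjective g
    exact ⟨f, congrArg (fun g => g.f.hom) hf⟩
  · let i := (Monad.comparison adj).objObjPreimageIso (monadAlgebra adj adj' (ModuleCat.of k N) r)
    refine ⟨_, ((Monad.forget adj.toMonad).mapIso i).toLinearEquiv, fun a x => ?_⟩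
    refine (congrArg i.hom.f.hom (map_counit_insertion adj x a)).symm.trans ?_
    have h := LinearMap.congr_fun (congrArg ModuleCat.Hom.hom i.hom.h) ((insertion adj x).hom a)
    refine h.symm.trans ?_
    refine Eq.trans ?_ (structureHom_insertion adj adj' (ModuleCat.of k N) r.act
      (i.hom.f.hom x) a)
    refine congrArg (structureHom adj adj' (ModuleCat.of k N) r.act).hom ?_
    exact LinearMap.congr_fun (congrArg ModuleCat.Hom.hom (insertion_comp adj x i.hom.f)) a

end GeneratorAlgebra

end

theorem IsMonadic.faithful {C : Type u₁} [Category.{v₁} C] {M : Type u₂} [Category.{v₂} M]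
    {G : C ⥤ M} (h : IsMonadic G) : G.Faithful := by
  obtain ⟨⟨L, adj, hadj⟩⟩ := h
  exact Functor.Faithful.of_iso (Monad.comparisonForget adj)

theorem mainTheorem5 (k : Type u) [CommRing k]
    (C : Type u₁) [Category.{v₁} C] [Preadditive C] [CategoryTheory.Linear k C]
    (G : C ⥤ ModuleCat.{u} k) [G.Additive] [G.Linear k] :
    (∃ (A : Type u) (_ : Ring A) (_ : Algebra k A) (_ : WeakBialgebra k A),
        EquivalentOver k G (longForgetful k A)) ↔
      (IsMonadic G ∧ G.IsLeftAdjoint ∧ CarriesSeparableFrobenius k G) := by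
  constructor
  · rintro ⟨A, _, _, _, K, _, _, ⟨φ⟩⟩
    have hm := isMonadic_of_equivalence (longForgetful_isMonadic k A) K φ
    have := hm.faithful
    have := longForgetful_isLeftAdjoint k A
    obtain ⟨R⟩ := Realization.nonempty_of_iso K φ
    obtain ⟨S⟩ := WeakBialgebra.nonempty_splitTensor R
    exact ⟨hm, Functor.isLeftAdjoint_of_iso φ.symm, S.carriesSeparableFrobenius k⟩
  · rintro ⟨hm, hl, _, _, _, ⟨S⟩⟩
    have := hm.faithful
    obtain ⟨⟨F, adj, hadj⟩⟩ := hm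
    let := GeneratorAlgebra.ring adj
    let := GeneratorAlgebra.algebra adj
    obtain ⟨R⟩ := GeneratorAlgebra.nonempty_realization adj (Adjunction.ofIsLeftAdjoint G)
    obtain ⟨W⟩ := R.nonempty_weakBialgebra S
    exact ⟨_, GeneratorAlgebra.ring adj, GeneratorAlgebra.algebra adj, W, R.equivalentOver⟩
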